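/- Let $\mathfrak g$ be a finite-dimensional simple Lie algebra over $\mathbb C$ with Cartan subalgebra $\mathfrak h$, root system $R$, set of simple roots $S\subset R_+$, weight lattice $P$, dominant weights $P_+$ and Weyl group $W$. Let $\overline S\subset S$, let $\overline R\subset R$ be the parabolic root system generated by $\overline S$, $\overline R_+=\overline R\cap R_+$, and let $\overline{\mathfrak g}=\mathfrak h\oplus\bigoplus_{\alpha\in\overline R}\mathfrak g_\alpha$ be the corresponding Levi subalgebra, with set of dominant integral weights $\overline P_+\subset P$. For $\lambda\in P_+$ and $\mu\in\overline P_+$ let $V(\lambda)$ and $\overline V(\mu)$ be the irreducible modules of $\mathfrak g$ and $\overline{\mathfrak g}$ of highest weights $\lambda$ and $\mu$, let $s_\lambda$ be the character of $V(\lambda)$, and let $m_\mu^\lambda$ be the multiplicity of $\overline V(\mu)$ in the restriction of $V(\lambda)$ to $\overline{\mathfrak g}$. Let $H_\mu=\sum_{\lambda\in P_+}m_\mu^\lambda s_\lambda$ (a formal, possibly infinite, combination of the irreducible characters $s_\lambda$), the character of the induced $\mathfrak g$-module $\overline V(\mu)\uparrow_{\overline{\mathfrak g}}^{\mathfrak g}$,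 where $N\uparrow_{\overline{\mathfrak g}}^{\mathfrak g}$ denotes the sum of all finite-dimensional $\mathfrak g$-submodules of $\mathrm{Hom}_{U(\overline{\mathfrak g})}(U(\mathfrak g),N)$. (1) An element $u\in W$ satisfies $u(\overline R_+)=\overline R_+$ if and only if $u$ is a Dynkin diagram automorphism of $\overline{\mathfrak g}$, i.e. $u$ permutes $\overline S$ and preserves the Cartan integers of its elements. (2) Let $\mu,\nu\in\overline P_+$, and suppose that there is $u\in W$ with $u(\overline R_+)=\overline R_+$ and $\nu=u(\mu)$ (equivalently, $\mu$ and $\nu$ are conjugate by a Dynkin diagram automorphism of $\overline{\mathfrak g}$ lying in $W$). Then $H_\mu=H_\nu$, and the induced modules $\overline V(\mu)\uparrow_{\overline{\mathfrak g}}^{\mathfrak g}$ and $\overline V(\nu)\uparrow_{\overline{\mathfrak g}}^{\mathfrak g}$ are isomorphic. -/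

import Mathlib

open Module LieAlgebra LieAlgebra.IsKilling

noncomputable section

namespace LeviInduction

section Enveloping

attribute [local instance 100] LieRing.ofAssociativeRing

lemma enveloping_lie {L : Type*} [LieRing L] [LieAlgebra ℂ L] (x y : L) :
    UniversalEnvelopingAlgebra.ι ℂ ⁅x, y⁆ =
      UniversalEnvelopingAlgebra.ι ℂ x * UniversalEnvelopingAlgebra.ι ℂ y -
        UniversalEnvelopingAlgebra.ι ℂ y * UniversalEnvelopingAlgebra.ι ℂ x := by
  rw [LieHom.map_lie, LieRing.of_associative_ring_bracket]

end Enveloping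

/-! ### Irreducible highest weight modules -/

section HighestWeight

variable (L : Type*) [LieRing L] [LieAlgebra ℂ L]
  {t : Type*} [LieRing t] [LieAlgebra ℂ t]
  (j : t →ₗ⁅ℂ⁆ L) (N : Set L) (lam : Dual ℂ t)

/-- The left ideal of `U(L)` generated by the elements of `N` and by the `h - lam h`, for `h` in
the torus `t` (mapped to `L` by `j`). -/
def vermaIdeal :
    Submodule (UniversalEnvelopingAlgebra ℂ L) (UniversalEnvelopingAlgebra ℂ L) :=
  Submodule.span (UniversalEnvelopingAlgebra ℂ L)
    ({y | ∃ x ∈ N, y = UniversalEnvelopingAlgebra.ι ℂ x} ∪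
      {y | ∃ h : t, y = UniversalEnvelopingAlgebra.ι ℂ (j h) -
        algebraMap ℂ (UniversalEnvelopingAlgebra ℂ L) (lam h)})

/-- The Verma module of highest weight `lam`. -/
abbrev VermaModule : Type _ := UniversalEnvelopingAlgebra ℂ L ⧸ vermaIdeal L j N lam

/-- The sum of all proper submodules of the Verma module (it is its largest proper submodule). -/
def vermaRadical : Submodule (UniversalEnvelopingAlgebra ℂ L) (VermaModule L j N lam) :=
  sSup {W | W ≠ ⊤}

/-- The irreducible module of highest weight `lam`: the quotient of the Verma module by its largest
proper submodule. -/
def IrreducibleModule : Type _ := VermaModule L j N lam ⧸ vermaRadical L j N lam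

instance : AddCommGroup (IrreducibleModule L j N lam) :=
  inferInstanceAs (AddCommGroup (VermaModule L j N lam ⧸ vermaRadical L j N lam))

instance : Module (UniversalEnvelopingAlgebra ℂ L) (IrreducibleModule L j N lam) :=
  inferInstanceAs (Module (UniversalEnvelopingAlgebra ℂ L)
    (VermaModule L j N lam ⧸ vermaRadical L j N lam))

instance : Module ℂ (IrreducibleModule L j N lam) :=
  inferInstanceAs (Module ℂ (VermaModule L j N lam ⧸ vermaRadical L j N lam))

instance : IsScalarTower ℂ (UniversalEnvelopingAlgebra ℂ L) (IrreducibleModule L j N lam) :=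
  inferInstanceAs (IsScalarTower ℂ (UniversalEnvelopingAlgebra ℂ L)
    (VermaModule L j N lam ⧸ vermaRadical L j N lam))

/-- `x` in `L` acts as its image in `U(L)`. -/
instance : LieRingModule L (IrreducibleModule L j N lam) where
  bracket x m := UniversalEnvelopingAlgebra.ι ℂ x • m
  add_lie x y m := by
    rw [map_add, add_smul]
  lie_add x m n := smul_add _ _ _
  leibniz_lie x y m := by
    change UniversalEnvelopingAlgebra.ι ℂ x • UniversalEnvelopingAlgebra.ι ℂ y • m =
      UniversalEnvelopingAlgebra.ι ℂ ⁅x, y⁆ • m +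
        UniversalEnvelopingAlgebra.ι ℂ y • UniversalEnvelopingAlgebra.ι ℂ x • m
    rw [enveloping_lie, sub_smul, mul_smul, mul_smul,
      sub_add_cancel]

instance : LieModule ℂ L (IrreducibleModule L j N lam) where
  smul_lie c x m := by
    change UniversalEnvelopingAlgebra.ι ℂ (c • x) • m = c • UniversalEnvelopingAlgebra.ι ℂ x • m
    rw [map_smul, smul_assoc]
  lie_smul c x m := by
    change UniversalEnvelopingAlgebra.ι ℂ x • c • m = c • UniversalEnvelopingAlgebra.ι ℂ x • m
    rw [← algebraMap_smul (UniversalEnvelopingAlgebra ℂ L) c m,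
      ← algebraMap_smul (UniversalEnvelopingAlgebra ℂ L) c
        (UniversalEnvelopingAlgebra.ι ℂ x • m), smul_smul, smul_smul,
      Algebra.commutes]

end HighestWeight

/-! ### Induction from a subalgebra -/

section Induction

variable {g : Type*} [LieRing g] [LieAlgebra ℂ g] (K : LieSubalgebra ℂ g)
  (N : Type*) [AddCommGroup N] [Module ℂ N] [LieRingModule K N] [LieModule ℂ K N]

/-- The space `Hom_{U(K)}(U(g), N)`. -/
def Coinduced : Submodule ℂ (UniversalEnvelopingAlgebra ℂ g →ₗ[ℂ] N) where
  carrier := {φ | ∀ (x : K) (y : UniversalEnvelopingAlgebra ℂ g),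
    φ (UniversalEnvelopingAlgebra.ι ℂ (x : g) * y) = ⁅x, φ y⁆}
  add_mem' := by
    intro φ ψ hφ hψ x y
    rw [LinearMap.add_apply, LinearMap.add_apply, hφ x y, hψ x y, lie_add]
  zero_mem' := by
    intro x y
    simp
  smul_mem' := by
    intro c φ hφ x y
    rw [LinearMap.smul_apply, LinearMap.smul_apply, hφ x y, lie_smul]

/-- `g` acts on `Hom_{U(K)}(U(g), N)` through right multiplication on `U(g)`. -/
instance : LieRingModule g (Coinduced K N) where
  bracket z φ := ⟨φ.1 ∘ₗ LinearMap.mulRight ℂ (UniversalEnvelopingAlgebra.ι ℂ z), by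
    intro x y
    simpa [mul_assoc] using φ.2 x (y * UniversalEnvelopingAlgebra.ι ℂ z)⟩
  add_lie z w φ := by
    refine Subtype.ext (LinearMap.ext fun y => ?_)
    change φ.1 (y * UniversalEnvelopingAlgebra.ι ℂ (z + w)) =
      φ.1 (y * UniversalEnvelopingAlgebra.ι ℂ z) + φ.1 (y * UniversalEnvelopingAlgebra.ι ℂ w)
    rw [map_add, mul_add, map_add]
  lie_add z φ ψ := rfl
  leibniz_lie z w φ := by
    refine Subtype.ext (LinearMap.ext fun y => ?_)
    change φ.1 (y * UniversalEnvelopingAlgebra.ι ℂ z * UniversalEnvelopingAlgebra.ι ℂ w) =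
      φ.1 (y * UniversalEnvelopingAlgebra.ι ℂ ⁅z, w⁆) +
        φ.1 (y * UniversalEnvelopingAlgebra.ι ℂ w * UniversalEnvelopingAlgebra.ι ℂ z)
    rw [enveloping_lie, mul_sub, map_sub, mul_assoc,
      mul_assoc, sub_add_cancel]

instance : LieModule ℂ g (Coinduced K N) where
  smul_lie c z φ := by
    refine Subtype.ext (LinearMap.ext fun y => ?_)
    change φ.1 (y * UniversalEnvelopingAlgebra.ι ℂ (c • z)) =
      c • φ.1 (y * UniversalEnvelopingAlgebra.ι ℂ z)
    rw [map_smul, mul_smul_comm, map_smul]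
  lie_smul c z φ := rfl

/-- The `g`-module induced from the `K`-module `N`: the sum of all the finite-dimensional
`g`-submodules of `Hom_{U(K)}(U(g), N)`. By Frobenius reciprocity, a finite-dimensional irreducible
`g`-module `V` occurs in it with multiplicity `dim Hom_K(V, N)`. -/
def Induced : LieSubmodule ℂ g (Coinduced K N) :=
  sSup {W | FiniteDimensional ℂ W}

end Induction

/-! ### Roots, weights and Levi subalgebras -/

section Levi

variable {g : Type*} [LieRing g] [LieAlgebra ℂ g] [FiniteDimensional ℂ g] [IsKilling ℂ g]
  {H : LieSubalgebra ℂ g} [H.IsCartanSubalgebra]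

/-- `P`: the integral weights. -/
def integralWeights (H : LieSubalgebra ℂ g) [H.IsCartanSubalgebra] : Set (Dual ℂ H) :=
  {β | ∀ α : H.root, ∃ n : ℤ, β ((rootSystem H).coroot α) = n}

/-- The integral weights that are nonnegative on the coroots of the elements of `T`. For `T = S`
(all the simple roots) this is `P_+`; for a subset `T` of `S` these are the dominant integral
weights of the corresponding Levi subalgebra. -/
def dominantWeights (T : Set H.root) : Set (Dual ℂ H) :=
  {β | β ∈ integralWeights H ∧ ∀ α ∈ T, ∃ n : ℕ, β ((rootSystem H).coroot α) = n}

/-- The parabolic root system generated by a set `T` of simple roots. -/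
def leviRoots (T : Set H.root) : Set (Dual ℂ H) :=
  {α | α ∈ Set.range (rootSystem H).root ∧ α ∈ Submodule.span ℤ ((rootSystem H).root '' T)}

/-- `R_+`: the positive roots with respect to the base `b`. -/
def positiveRoots (b : (rootSystem H).Base) : Set (Dual ℂ H) :=
  {α | ∃ i : H.root, b.IsPos i ∧ (rootSystem H).root i = α}

/-- The positive roots of the parabolic root system generated by `T`. -/
def leviPositiveRoots (b : (rootSystem H).Base) (T : Set H.root) : Set (Dual ℂ H) :=
  leviRoots T ∩ positiveRoots b

/-- An element `u` of the Weyl group of `g` is a Dynkin diagram automorphism of the Levi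
subalgebra given by `T` if it permutes the simple roots in `T` and preserves their Cartan
integers. -/
def IsDynkinAutomorphism (T : Set H.root) (u : (rootSystem H).weylGroup) : Prop :=
  ∃ σ : Equiv.Perm T, (∀ i : T, u • (rootSystem H).root i = (rootSystem H).root (σ i)) ∧
    ∀ i k : T, (rootSystem H).pairing (σ i) (σ k) = (rootSystem H).pairing i k

/-- The subspace `h ⊕ ⨁_α g_α`, where `α` runs over the parabolic root system generated by `T`. -/
def leviSubmodule (T : Set H.root) : Submodule ℂ g :=
  H.toSubmodule ⊔ ⨆ α ∈ leviRoots T, (rootSpace H (α : H → ℂ)).toSubmodule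

lemma rootSpace_le_leviSubmodule (T : Set H.root) (χ : Dual ℂ H)
    (hχ : χ ∈ Submodule.span ℤ ((rootSystem H).root '' T)) :
    (rootSpace H (χ : H → ℂ)).toSubmodule ≤ leviSubmodule T := by
  by_cases h0 : χ = 0
  · subst h0
    refine le_trans ?_ le_sup_left
    intro x hx
    have : x ∈ rootSpace H (0 : H → ℂ) := hx
    rwa [LieAlgebra.rootSpace_zero_eq] at this
  · by_cases hb : rootSpace H (χ : H → ℂ) = ⊥
    · simp [hb]
    · refine le_trans ?_ le_sup_right
      have hr : χ ∈ leviRoots T := by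
        refine ⟨⟨⟨⟨χ, hb⟩, ?_⟩, ?_⟩, hχ⟩
        · simp only [LieSubalgebra.root, Finset.mem_filter, Finset.mem_univ, true_and]
          exact fun h => h0 (DFunLike.coe_injective h)
        · ext; rfl
      exact le_iSup₂_of_le χ hr le_rfl

lemma leviSubmodule_eq_iSup (T : Set H.root) :
    leviSubmodule T = ⨆ χ : Submodule.span ℤ ((rootSystem H).root '' T),
      (rootSpace H ((χ : Dual ℂ H) : H → ℂ)).toSubmodule := by
  apply le_antisymm
  · refine sup_le ?_ (iSup₂_le fun α hα => le_iSup_of_le ⟨α, hα.2⟩ le_rfl)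
    refine le_iSup_of_le 0 ?_
    intro x hx
    change x ∈ rootSpace H (0 : H → ℂ)
    rw [LieAlgebra.rootSpace_zero_eq]
    exact hx
  · exact iSup_le fun χ => rootSpace_le_leviSubmodule T χ χ.2

lemma lie_mem_leviSubmodule (T : Set H.root) {x y : g} (hx : x ∈ leviSubmodule T)
    (hy : y ∈ leviSubmodule T) : ⁅x, y⁆ ∈ leviSubmodule T := by
  rw [leviSubmodule_eq_iSup] at hx hy
  induction hx using Submodule.iSup_induction' with
  | zero => simp
  | add x₁ x₂ _ _ h₁ h₂ => simpa using add_mem h₁ h₂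
  | mem χ x hx =>
    induction hy using Submodule.iSup_induction' with
    | zero => simp
    | add y₁ y₂ _ _ h₁ h₂ => simpa using add_mem h₁ h₂
    | mem ψ y hy =>
      refine rootSpace_le_leviSubmodule T (χ + ψ) (add_mem χ.2 ψ.2) ?_
      exact lie_mem_genWeightSpace_of_mem_genWeightSpace hx hy

/-- The Levi subalgebra with Cartan subalgebra `H` and root system generated by `T`. -/
def leviSubalgebra (T : Set H.root) : LieSubalgebra ℂ g where
  __ := leviSubmodule T
  lie_mem' := by
    intro x y hx hy
    exact lie_mem_leviSubmodule T hx hy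

lemma cartan_le_leviSubalgebra (T : Set H.root) : H ≤ leviSubalgebra T :=
  fun _ hx => (le_sup_left : H.toSubmodule ≤ leviSubmodule T) hx

/-- `V(lam)`: the irreducible `g`-module of highest weight `lam`. -/
abbrev V (b : (rootSystem H).Base) (lam : Dual ℂ H) : Type _ :=
  IrreducibleModule g H.incl {x : g | ∃ α ∈ positiveRoots b, x ∈ rootSpace H (α : H → ℂ)} lam

/-- The irreducible module of highest weight `mu` of the Levi subalgebra given by `T`. -/
abbrev VLevi (b : (rootSystem H).Base) (T : Set H.root) (mu : Dual ℂ H) : Type _ :=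
  IrreducibleModule (leviSubalgebra T)
    (LieSubalgebra.inclusion (cartan_le_leviSubalgebra T))
    {x : leviSubalgebra T | ∃ α ∈ leviPositiveRoots b T, (x : g) ∈ rootSpace H (α : H → ℂ)} mu

/-- The branching coefficient: the multiplicity of the irreducible module of highest weight `mu` of
the Levi subalgebra in the (semisimple) restriction of `V(lam)` to the Levi subalgebra. -/
def branchingCoefficient (b : (rootSystem H).Base) (T : Set H.root) (lam mu : Dual ℂ H) : ℕ :=
  finrank ℂ (VLevi b T mu →ₗ⁅ℂ, leviSubalgebra T⁆ V b lam)

/-- `H_mu`: the formal, possibly infinite, integral combination `∑ m(lam, mu) s_lam` of the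
irreducible characters `s_lam` of `g`, for `lam` in `P_+`, given by its family of coefficients. -/
def inducedCharacter (b : (rootSystem H).Base) (T : Set H.root) (mu : Dual ℂ H) :
    dominantWeights (b.support : Set H.root) → ℤ :=
  fun lam => branchingCoefficient b T lam mu

/-- The `g`-module induced from the irreducible module of highest weight `mu` of the Levi
subalgebra given by `T`. -/
abbrev InducedModule (b : (rootSystem H).Base) (T : Set H.root) (mu : Dual ℂ H) :
    LieSubmodule ℂ g (Coinduced (leviSubalgebra T) (VLevi b T mu)) :=
  Induced (leviSubalgebra T) (VLevi b T mu)

end Levi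

end LeviInduction

end

/-!
# Induction from Levi subalgebras and Dynkin diagram automorphisms

Let `u` be an element of the Weyl group preserving the positive roots of the Levi subalgebra.

*The combinatorial equivalence.* The positive roots of the Levi subalgebra are the roots that are
sums of elements of `T` (`mem_leviPositiveRoots_iff`), and the elements of `T` are the
indecomposable ones among them; `u` permutes the indecomposables
(`smul_root_mem_of_image_eq`, `image_leviPositiveRoots_eq_iff`).

*Conjugate weights.* The element `u` lifts to an automorphism `θ` of `g` that preserves the Cartan
subalgebra, namely a product of automorphisms `exp (ad e) exp (- ad f) exp (ad e)` for
`sl₂`-triples of simple roots (`exists_isLift`). As `u` preserves the positive roots of the Levi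
subalgebra, `θ` restricts to the Levi subalgebra and carries its irreducible module of highest
weight `μ` to the one of highest weight `u μ` (`exists_irreducibleModule_equiv`,
`exists_levi_automorphism`). On the other hand, since `θ` is a product of exponentials, twisting by
`θ` does not change the isomorphism class of a `g`-module on which the simple root vectors and their
negatives act locally nilpotently: the corresponding product of exponentials acts on the module and
intertwines it with its twist (`IsImplemented`, `expSum_lie`). Two kinds of modules have this
property:

* `V(λ)` for dominant integral `λ` (`isIntegrable_V`). If `v` is the highest weight vector and `n`
  the value of `λ` on the coroot of a simple root, then `f ^ (n + 1) v` is a singular vector, hence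
  generates a submodule not containing `v`, hence vanishes by irreducibility. The
  finite-dimensionality of `V(λ)` is not used.
* A sum of finite-dimensional modules (`isIntegrable_sSup_finiteDimensional`), in particular an
  induced module.

Composing with the twists gives an isomorphism from `Hom(V(μ), V(λ))` to `Hom(V(u μ), V(λ))`, the
`Hom` spaces being over the Levi subalgebra, and an isomorphism of the two induced modules.
-/

noncomputable section

namespace LeviInduction

/-! ### Exponentials of locally nilpotent endomorphisms -/

section LocalExp

open Finset

variable {K : Type*} [Field K]
  {M : Type*} [AddCommGroup M] [Module K M]
  {M₁ : Type*} [AddCommGroup M₁] [Module K M₁]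
  {M₂ : Type*} [AddCommGroup M₂] [Module K M₂]

/-- An endomorphism is locally nilpotent if every vector is killed by one of its powers. -/
def IsLocallyNilpotent (a : End K M) : Prop := ∀ m, ∃ n, (a ^ n) m = 0

lemma IsLocallyNilpotent.neg {a : End K M} (ha : IsLocallyNilpotent a) :
    IsLocallyNilpotent (-a) := by
  intro m
  obtain ⟨n, hn⟩ := ha m
  refine ⟨n, ?_⟩
  rw [neg_pow, Module.End.mul_apply, hn, map_zero]

lemma IsLocallyNilpotent.of_isNilpotent {a : End K M} (ha : IsNilpotent a) :
    IsLocallyNilpotent a := by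
  obtain ⟨n, hn⟩ := ha
  exact fun m => ⟨n, by rw [hn, LinearMap.zero_apply]⟩

lemma pow_apply_eq_zero_of_le {a : End K M} {m : M} {N n : ℕ} (hN : (a ^ N) m = 0) (h : N ≤ n) :
    (a ^ n) m = 0 :=
  Module.End.pow_map_zero_of_le h hN

/-- The exponential series `∑ aⁿ m / n!` as a function of `m`; the sum is finite at every `m`
killed by a power of `a`, and has the junk value `0` where it is infinite. -/
def expSum (a : End K M) (m : M) : M := ∑ᶠ n : ℕ, (n.factorial : K)⁻¹ • (a ^ n) m

lemma expSum_eq {a : End K M} {m : M} {N : ℕ} (hN : (a ^ N) m = 0) :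
    expSum a m = ∑ n ∈ range N, (n.factorial : K)⁻¹ • (a ^ n) m := by
  refine finsum_eq_sum_of_support_subset _ fun n hn => ?_
  by_contra h
  rw [coe_range, Set.mem_Iio, not_lt] at h
  exact hn (by simp only [pow_apply_eq_zero_of_le hN h, smul_zero])

lemma expSum_add {a : End K M} (ha : IsLocallyNilpotent a) (x y : M) :
    expSum a (x + y) = expSum a x + expSum a y := by
  obtain ⟨n₁, h₁⟩ := ha x
  obtain ⟨n₂, h₂⟩ := ha y
  have h₁' := pow_apply_eq_zero_of_le h₁ (le_max_left n₁ n₂)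
  have h₂' := pow_apply_eq_zero_of_le h₂ (le_max_right n₁ n₂)
  rw [expSum_eq h₁', expSum_eq h₂',
    expSum_eq (N := max n₁ n₂) (by rw [map_add, h₁', h₂', add_zero]),
    ← sum_add_distrib]
  simp only [map_add, smul_add]

lemma expSum_smul {a : End K M} (ha : IsLocallyNilpotent a) (c : K) (x : M) :
    expSum a (c • x) = c • expSum a x := by
  obtain ⟨n, h⟩ := ha x
  rw [expSum_eq h, expSum_eq (N := n) (by rw [map_smul, h, smul_zero]), smul_sum]
  simp only [map_smul, smul_comm c]

/-- Summing over the antidiagonals of a large triangle sums over the whole rectangle supporting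
`f`. -/
lemma sum_range_sum_antidiagonal {f : ℕ → ℕ → M} {N₁ N₂ : ℕ}
    (hf : ∀ i j, N₁ ≤ i ∨ N₂ ≤ j → f i j = 0) :
    ∑ n ∈ range (N₁ + N₂), ∑ p ∈ antidiagonal n, f p.1 p.2 =
      ∑ i ∈ range N₁, ∑ j ∈ range N₂, f i j := by
  rw [sum_sigma', ← sum_product']
  refine sum_bij_ne_zero (fun p _ _ => p.2) ?_ ?_ ?_ ?_
  · rintro ⟨n, i, j⟩ h h0
    rw [mem_product, mem_range, mem_range]
    by_contra hc
    exact h0 (hf _ _ (by grind))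
  · rintro ⟨n, i, j⟩ h - ⟨n', i', j'⟩ h' - hp
    simp only [mem_sigma, HasAntidiagonal.mem_antidiagonal] at h h'
    obtain ⟨rfl, rfl⟩ := Prod.mk.inj hp
    obtain rfl : n = n' := h.2.symm.trans h'.2
    rfl
  · rintro ⟨i, j⟩ h h0
    rw [mem_product, mem_range, mem_range] at h
    exact ⟨⟨i + j, i, j⟩, mem_sigma.2 ⟨mem_range.2 (add_lt_add h.1 h.2),
      HasAntidiagonal.mem_antidiagonal.2 rfl⟩, h0, rfl⟩
  · rintro ⟨n, i, j⟩ h h0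
    rfl

variable [CharZero K]

lemma inv_factorial_mul_choose {n i j : ℕ} (h : i + j = n) :
    (n.factorial : K)⁻¹ * (n.choose i : K) = (i.factorial : K)⁻¹ * (j.factorial : K)⁻¹ := by
  subst h
  have h1 : ((i + j).factorial : K) ≠ 0 := by exact_mod_cast Nat.factorial_ne_zero _
  have h2 : (i.factorial : K) ≠ 0 := by exact_mod_cast Nat.factorial_ne_zero _
  have h3 : (j.factorial : K) ≠ 0 := by exact_mod_cast Nat.factorial_ne_zero _
  have h4 : ((i + j).choose i : K) * i.factorial * j.factorial = (i + j).factorial := by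
    rw [Nat.choose_symm_add]
    exact_mod_cast Nat.add_choose_mul_factorial_mul_factorial i j
  field_simp
  linear_combination h4

/-- If a bilinear map intertwines `a` and `b` with `c` as in the Leibniz rule, then it intertwines
their exponentials. -/
lemma expSum_bilinear {a : End K M₁} {b : End K M₂} {c : End K M} (β : M₁ →ₗ[K] M₂ →ₗ[K] M)
    (h : ∀ x y, c (β x y) = β (a x) y + β x (b y)) (ha : IsLocallyNilpotent a)
    (hb : IsLocallyNilpotent b) (x : M₁) (y : M₂) :
    expSum c (β x y) = β (expSum a x) (expSum b y) := by
  have hpow (n : ℕ) : (c ^ n) (β x y) =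
      ∑ p ∈ antidiagonal n, n.choose p.1 • β ((a ^ p.1) x) ((b ^ p.2) y) := by
    induction n with
    | zero => simp
    | succ n ih =>
      rw [sum_antidiagonal_choose_succ_nsmul (fun i j => β ((a ^ i) x) ((b ^ j) y)) n, pow_succ',
        Module.End.mul_apply, ih, map_sum, ← sum_add_distrib]
      refine sum_congr rfl fun p hp => ?_
      rw [HasAntidiagonal.mem_antidiagonal] at hp
      subst hp
      rw [← Nat.choose_symm_add, map_nsmul, h, ← Module.End.mul_apply,
        ← Module.End.mul_apply, ← pow_succ', ← pow_succ',
        nsmul_add, add_comm]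
  obtain ⟨N₁, h₁⟩ := ha x
  obtain ⟨N₂, h₂⟩ := hb y
  have key := sum_range_sum_antidiagonal (N₁ := N₁) (N₂ := N₂)
    (f := fun i j => ((i.factorial : K)⁻¹ * (j.factorial : K)⁻¹) • β ((a ^ i) x) ((b ^ j) y)) (by
      rintro i j (hi | hj)
      · simp only [pow_apply_eq_zero_of_le h₁ hi, map_zero, LinearMap.zero_apply, smul_zero]
      · simp only [pow_apply_eq_zero_of_le h₂ hj, map_zero, smul_zero])
  have hterm (n : ℕ) : (n.factorial : K)⁻¹ • (c ^ n) (β x y) = ∑ p ∈ antidiagonal n,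
      ((p.1.factorial : K)⁻¹ * (p.2.factorial : K)⁻¹) • β ((a ^ p.1) x) ((b ^ p.2) y) := by
    rw [hpow, smul_sum]
    refine sum_congr rfl fun p hp => ?_
    rw [← Nat.cast_smul_eq_nsmul K, smul_smul,
      inv_factorial_mul_choose (HasAntidiagonal.mem_antidiagonal.1 hp)]
  have hzero : (c ^ (N₁ + N₂)) (β x y) = 0 := by
    rw [hpow]
    refine sum_eq_zero fun p hp => ?_
    rw [HasAntidiagonal.mem_antidiagonal] at hp
    rcases le_or_gt N₁ p.1 with hi | hi
    · rw [pow_apply_eq_zero_of_le h₁ hi, map_zero, LinearMap.zero_apply, smul_zero]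
    · rw [pow_apply_eq_zero_of_le h₂ (by omega), map_zero, smul_zero]
  rw [expSum_eq hzero, sum_congr rfl fun n _ => hterm n, key, expSum_eq h₁, expSum_eq h₂]
  simp only [map_sum, LinearMap.sum_apply, map_smul, LinearMap.smul_apply, smul_sum, smul_smul]
  rw [Finset.sum_comm]
  simp only [mul_comm]

/-- As in `expSum_bilinear`, the double sum is reordered along antidiagonals; the term of degree `n`
is `(a - a)ⁿ m / n!`. -/
lemma expSum_expSum_neg {a : End K M} (ha : IsLocallyNilpotent a) (m : M) :
    expSum a (expSum (-a) m) = m := by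
  obtain ⟨N, hN⟩ := ha m
  have hN' : ((-a) ^ N) m = 0 := by rw [neg_pow, Module.End.mul_apply, hN, map_zero]
  have hcomm (i j : ℕ) : (a ^ i) (((-a) ^ j) m) = ((-a) ^ j) ((a ^ i) m) := by
    rw [← Module.End.mul_apply, ← Module.End.mul_apply,
      (((Commute.refl a).neg_right).pow_pow i j).eq]
  have hexp : (a ^ N) (expSum (-a) m) = 0 := by
    rw [expSum_eq hN', map_sum]
    refine sum_eq_zero fun j _ => ?_
    rw [map_smul, hcomm, hN, map_zero, smul_zero]
  have key := sum_range_sum_antidiagonal (N₁ := N) (N₂ := N)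
    (f := fun i j => ((i.factorial : K)⁻¹ * (j.factorial : K)⁻¹) • (a ^ i) (((-a) ^ j) m)) (by
      rintro i j (hi | hj)
      · simp only [hcomm, pow_apply_eq_zero_of_le hN hi, map_zero, smul_zero]
      · simp only [pow_apply_eq_zero_of_le hN' hj, map_zero, smul_zero])
  have hterm (n : ℕ) : ∑ p ∈ antidiagonal n,
      ((p.1.factorial : K)⁻¹ * (p.2.factorial : K)⁻¹) • (a ^ p.1) (((-a) ^ p.2) m) =
        if n = 0 then m else 0 := by
    have h1 : (n.factorial : K)⁻¹ • ((a + -a) ^ n) m = ∑ p ∈ antidiagonal n,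
        ((p.1.factorial : K)⁻¹ * (p.2.factorial : K)⁻¹) • (a ^ p.1) (((-a) ^ p.2) m) := by
      rw [((Commute.refl a).neg_right).add_pow', LinearMap.sum_apply, smul_sum]
      refine sum_congr rfl fun p hp => ?_
      rw [LinearMap.smul_apply, ← Nat.cast_smul_eq_nsmul K, smul_smul,
        inv_factorial_mul_choose (HasAntidiagonal.mem_antidiagonal.1 hp), Module.End.mul_apply]
    rw [← h1, add_neg_cancel]
    split_ifs with h
    · simp [h]
    · rw [zero_pow h, LinearMap.zero_apply, smul_zero]
  rw [expSum_eq hexp, expSum_eq hN']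
  simp only [map_sum, map_smul, smul_sum, smul_smul]
  rw [← key, sum_congr rfl fun n _ => hterm n]
  rcases Nat.eq_zero_or_pos N with rfl | h
  · simpa using hN.symm
  · rw [sum_ite_eq' (range (N + N)) 0 fun _ => m, if_pos (mem_range.2 (by omega))]

/-- The exponential of a locally nilpotent endomorphism, as an automorphism. -/
def locExp {a : End K M} (ha : IsLocallyNilpotent a) : M ≃ₗ[K] M where
  toFun := expSum a
  map_add' := expSum_add ha
  map_smul' := expSum_smul ha
  invFun := expSum (-a)
  left_inv m := by
    simpa using expSum_expSum_neg ha.neg m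
  right_inv := expSum_expSum_neg ha

end LocalExp

/-! ### Weyl group elements preserving the positive roots of a Levi subalgebra -/

section Combinatorics

variable {g : Type*} [LieRing g] [LieAlgebra ℂ g] [FiniteDimensional ℂ g] [IsKilling ℂ g]
  {H : LieSubalgebra ℂ g} [H.IsCartanSubalgebra] (b : (rootSystem H).Base) {T : Set H.root}

/-- There is an element of the Cartan subalgebra at which every root takes its height as value. -/
lemma exists_grading_element : ∃ h₀ : H, ∀ i : H.root, (rootSystem H).root i h₀ = b.height i := by
  let φ : Dual ℂ (Dual ℂ H) := b.toWeightBasis.constr ℂ fun _ => (1 : ℂ)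
  refine ⟨(evalEquiv ℂ H).symm φ, fun i => ?_⟩
  have hφ (j : H.root) (hj : j ∈ b.support) : φ ((rootSystem H).root j) = 1 := by
    have := b.toWeightBasis.constr_basis ℂ (fun _ => (1 : ℂ)) ⟨j, hj⟩
    rwa [b.toWeightBasis_apply] at this
  obtain ⟨f, -, -, hf⟩ := b.exists_root_eq_sum_int i
  rw [apply_evalEquiv_symm_apply, RootPairing.Base.height_eq_sum hf, hf, map_sum, Int.cast_sum]
  refine Finset.sum_congr rfl fun j hj => ?_
  rw [map_zsmul, hφ j hj, zsmul_eq_mul, mul_one]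

lemma weylGroup_smul_mem_range_root (u : (rootSystem H).weylGroup) {α : Dual ℂ H}
    (hα : α ∈ Set.range (rootSystem H).root) : u • α ∈ Set.range (rootSystem H).root := by
  obtain ⟨i, rfl⟩ := hα
  exact ⟨_, ((rootSystem H).weylGroup_apply_root u i).symm⟩

lemma closure_le_span (T : Set H.root) {α : Dual ℂ H}
    (hα : α ∈ AddSubmonoid.closure ((rootSystem H).root '' T)) :
    α ∈ Submodule.span ℤ ((rootSystem H).root '' T) :=
  (AddSubmonoid.closure_le (S := (Submodule.span ℤ
    ((rootSystem H).root '' T)).toAddSubmonoid)).2 Submodule.subset_span hα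

lemma exists_nat_of_mem_closure (hT : T ⊆ (b.support : Set H.root)) {h₀ : H}
    (h₀' : ∀ i : H.root, (rootSystem H).root i h₀ = b.height i) {α : Dual ℂ H}
    (hα : α ∈ AddSubmonoid.closure ((rootSystem H).root '' T)) : ∃ n : ℕ, α h₀ = n := by
  induction hα using AddSubmonoid.closure_induction with
  | mem x hx =>
    obtain ⟨i, hi, rfl⟩ := hx
    exact ⟨1, by rw [h₀', RootPairing.Base.height_one_of_mem_support (hT hi), Int.cast_one,
      Nat.cast_one]⟩
  | zero => exact ⟨0, by simp⟩
  | add x y _ _ hx hy =>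
    obtain ⟨m, hm⟩ := hx
    obtain ⟨n, hn⟩ := hy
    exact ⟨m + n, by simp [hm, hn]⟩

/-- The positive roots of the Levi subalgebra are the roots that are sums of elements of `T`. -/
lemma mem_leviPositiveRoots_iff (hT : T ⊆ (b.support : Set H.root)) {α : Dual ℂ H} :
    α ∈ leviPositiveRoots b T ↔ α ∈ Set.range (rootSystem H).root ∧
      α ∈ AddSubmonoid.closure ((rootSystem H).root '' T) := by
  constructor
  · rintro ⟨⟨hα, hspan⟩, i, hi, rfl⟩
    refine ⟨hα, ?_⟩
    obtain ⟨f, -, hpos, hf⟩ := b.exists_root_eq_sum_int i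
    have hf0 : 0 ≤ f := by
      refine (hpos.resolve_right fun hneg => ?_).le
      rw [RootPairing.Base.isPos_iff, RootPairing.Base.height_eq_sum hf] at hi
      exact hi.not_ge (Finset.sum_nonpos fun j _ => hneg.le j)
    -- the coordinates of an element of the span of `T` vanish outside `T`
    have hout (j : b.support) (hj : (j : H.root) ∉ T) : f j = 0 := by
      have h1 : b.toWeightBasis.coord j ((rootSystem H).root i) = f j := by
        rw [hf, map_sum, Finset.sum_eq_single_of_mem (j : H.root) j.2]
        · rw [map_zsmul, Basis.coord_apply, b.toWeightBasis_repr_root]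
          simp
        · intro k hk hkj
          rw [map_zsmul, Basis.coord_apply, b.toWeightBasis_repr_root ⟨k, hk⟩,
            Finsupp.single_eq_of_ne (fun h => hkj (congrArg Subtype.val h).symm), smul_zero]
      have h2 : ∀ x ∈ Submodule.span ℤ ((rootSystem H).root '' T),
          b.toWeightBasis.coord j x = 0 := by
        intro x hx
        induction hx using Submodule.span_induction with
        | mem x hx =>
          obtain ⟨k, hk, rfl⟩ := hx
          rw [Basis.coord_apply, b.toWeightBasis_repr_root ⟨k, hT hk⟩,
            Finsupp.single_eq_of_ne]
          rintro rfl
          exact hj hk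
        | zero => exact map_zero _
        | add x y _ _ hx hy => rw [map_add, hx, hy, add_zero]
        | smul c x _ hx => rw [map_zsmul, hx, smul_zero]
      have h3 := h2 _ hspan
      rw [h1] at h3
      exact_mod_cast h3
    rw [hf]
    refine AddSubmonoid.sum_mem _ fun j hj => ?_
    by_cases hjT : j ∈ T
    · obtain ⟨n, hn⟩ := Int.eq_ofNat_of_zero_le (hf0 j)
      rw [hn, natCast_zsmul]
      exact AddSubmonoid.nsmul_mem _ (AddSubmonoid.subset_closure (Set.mem_image_of_mem _ hjT)) n
    · rw [hout ⟨j, hj⟩ hjT, zero_smul]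
      exact zero_mem _
  · rintro ⟨hα, hcl⟩
    refine ⟨⟨hα, closure_le_span T hcl⟩, ?_⟩
    obtain ⟨i, rfl⟩ := hα
    refine ⟨i, ?_, rfl⟩
    obtain ⟨h₀, hh₀⟩ := exists_grading_element b
    obtain ⟨n, hn⟩ := exists_nat_of_mem_closure b hT hh₀ hcl
    rw [hh₀] at hn
    rw [RootPairing.Base.isPos_iff']
    have : b.height i = n := by exact_mod_cast hn
    omega

lemma root_mem_leviPositiveRoots (hT : T ⊆ (b.support : Set H.root)) {i : H.root} (hi : i ∈ T) :
    (rootSystem H).root i ∈ leviPositiveRoots b T :=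
  (mem_leviPositiveRoots_iff b hT).2 ⟨⟨i, rfl⟩, AddSubmonoid.subset_closure ⟨i, hi, rfl⟩⟩

/-- If `u` preserves the positive roots of the Levi subalgebra, it maps simple roots of the Levi
subalgebra to simple roots: these are the positive roots that are not sums of several others. -/
lemma smul_root_mem_of_image_eq (hT : T ⊆ (b.support : Set H.root))
    {u : (rootSystem H).weylGroup}
    (hu : (fun α => u • α) '' leviPositiveRoots b T = leviPositiveRoots b T) {i : H.root}
    (hi : i ∈ T) : u • (rootSystem H).root i ∈ (rootSystem H).root '' T := by
  obtain ⟨h₀, hh₀⟩ := exists_grading_element b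
  -- a sum `x` of elements of `T` is decomposable as soon as `u⁻¹ x` has height at least two
  have key : ∀ x ∈ AddSubmonoid.closure ((rootSystem H).root '' T),
      ∃ n : ℕ, (u⁻¹ • x) h₀ = n ∧ (n = 0 → x = 0) ∧ (n = 1 → x ∈ (rootSystem H).root '' T) := by
    intro x hx
    induction hx using AddSubmonoid.closure_induction with
    | mem x hx =>
      obtain ⟨j, hj, rfl⟩ := hx
      have h1 := root_mem_leviPositiveRoots b hT hj
      rw [← hu] at h1
      obtain ⟨α, hα, h2 : u • α = _⟩ := h1
      obtain ⟨-, k, hk, rfl⟩ := hα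
      rw [RootPairing.Base.isPos_iff] at hk
      obtain ⟨n, hn⟩ := Int.eq_ofNat_of_zero_le hk.le
      refine ⟨n, ?_, fun h => ?_, fun _ => ⟨j, hj, rfl⟩⟩
      · rw [← h2, inv_smul_smul, hh₀, hn, Int.cast_natCast]
      · omega
    | zero => exact ⟨0, by simp, fun _ => rfl, by simp⟩
    | add x y _ _ hx hy =>
      obtain ⟨m, hm, hm0, hm1⟩ := hx
      obtain ⟨n, hn, hn0, hn1⟩ := hy
      refine ⟨m + n, by simp [smul_add, hm, hn], fun h => ?_, fun h => ?_⟩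
      · rw [hm0 (by omega), hn0 (by omega), add_zero]
      · rcases Nat.eq_zero_or_pos m with h0 | h0
        · rw [hm0 h0, zero_add]
          exact hn1 (by omega)
        · rw [hn0 (by omega), add_zero]
          exact hm1 (by omega)
  have hmem : u • (rootSystem H).root i ∈ leviPositiveRoots b T := by
    rw [← hu]
    exact ⟨_, root_mem_leviPositiveRoots b hT hi, rfl⟩
  obtain ⟨n, hn, -, hn1⟩ := key _ ((mem_leviPositiveRoots_iff b hT).1 hmem).2
  rw [inv_smul_smul, hh₀, RootPairing.Base.height_one_of_mem_support (hT hi)] at hn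
  exact hn1 (by exact_mod_cast hn.symm)

/-- If `u` maps the simple roots of the Levi subalgebra to simple roots of it, it preserves its
positive roots. -/
lemma smul_mem_leviPositiveRoots (hT : T ⊆ (b.support : Set H.root))
    {u : (rootSystem H).weylGroup}
    (hu : ∀ i ∈ T, u • (rootSystem H).root i ∈ (rootSystem H).root '' T) {α : Dual ℂ H}
    (hα : α ∈ leviPositiveRoots b T) : u • α ∈ leviPositiveRoots b T := by
  rw [mem_leviPositiveRoots_iff b hT] at hα ⊢
  refine ⟨weylGroup_smul_mem_range_root u hα.1, ?_⟩
  obtain ⟨-, hα⟩ := hα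
  induction hα using AddSubmonoid.closure_induction with
  | mem x hx =>
    obtain ⟨i, hi, rfl⟩ := hx
    exact AddSubmonoid.subset_closure (hu i hi)
  | zero => simp
  | add x y _ _ hx hy =>
    rw [smul_add]
    exact add_mem hx hy

lemma pairing_weylGroup_smul (u : (rootSystem H).weylGroup) {i j i' j' : H.root}
    (hi : u • (rootSystem H).root i = (rootSystem H).root i')
    (hj : u • (rootSystem H).root j = (rootSystem H).root j') :
    (rootSystem H).pairing i' j' = (rootSystem H).pairing i j := by
  let f := (u : (rootSystem H).Aut).toHom
  have h1 : f.indexEquiv.symm j' = j := by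
    rw [Equiv.symm_apply_eq]
    exact (rootSystem H).root.injective (hj.symm.trans (f.root_weightMap_apply _ _ j))
  have h2 := LinearMap.congr_fun (f.weight_coweight_transpose_apply _ _
    ((rootSystem H).coroot j')) ((rootSystem H).root i)
  rw [f.coroot_coweightMap_apply, h1] at h2
  have h3 : f.weightMap ((rootSystem H).root i) = (rootSystem H).root i' := hi
  rw [LinearMap.dualMap_apply, h3] at h2
  exact h2

lemma image_leviPositiveRoots_eq_iff (hT : T ⊆ (b.support : Set H.root))
    (u : (rootSystem H).weylGroup) :
    (fun α => u • α) '' leviPositiveRoots b T = leviPositiveRoots b T ↔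
      IsDynkinAutomorphism T u := by
  constructor
  · intro hu
    choose! σ hσT hσ using fun i hi => smul_root_mem_of_image_eq b hT hu (i := i) hi
    have hinj : Function.Injective fun i : T => (⟨σ i, hσT i i.2⟩ : T) := by
      intro i j hij
      have h1 : σ i = σ j := congrArg Subtype.val hij
      have h2 := hσ i i.2
      rw [h1, hσ j j.2] at h2
      exact Subtype.ext ((rootSystem H).root.injective (MulAction.injective u h2)).symm
    refine ⟨Equiv.ofBijective _ (Finite.injective_iff_bijective.1 hinj),
      fun i => (hσ i i.2).symm, fun i k => ?_⟩
    exact pairing_weylGroup_smul u (hσ i i.2).symm (hσ k k.2).symm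
  · rintro ⟨σ, hσ, -⟩
    apply Set.Subset.antisymm
    · rintro _ ⟨α, hα, rfl⟩
      exact smul_mem_leviPositiveRoots b hT
        (fun i hi => ⟨σ ⟨i, hi⟩, (σ ⟨i, hi⟩).2, (hσ ⟨i, hi⟩).symm⟩) hα
    · intro α hα
      refine ⟨u⁻¹ • α, smul_mem_leviPositiveRoots b hT (fun i hi => ?_) hα, smul_inv_smul u α⟩
      refine ⟨σ.symm ⟨i, hi⟩, (σ.symm ⟨i, hi⟩).2, ?_⟩
      rw [eq_inv_smul_iff, hσ, Equiv.apply_symm_apply]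

lemma smul_mem_span (hT : T ⊆ (b.support : Set H.root)) {u : (rootSystem H).weylGroup}
    (hu : (fun α => u • α) '' leviPositiveRoots b T = leviPositiveRoots b T) {α : Dual ℂ H}
    (hα : α ∈ Submodule.span ℤ ((rootSystem H).root '' T)) :
    u • α ∈ Submodule.span ℤ ((rootSystem H).root '' T) := by
  induction hα using Submodule.span_induction with
  | mem x hx =>
    obtain ⟨i, hi, rfl⟩ := hx
    exact Submodule.subset_span (smul_root_mem_of_image_eq b hT hu hi)
  | zero => simp
  | add x y _ _ hx hy =>
    rw [smul_add]
    exact add_mem hx hy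
  | smul c x _ hx =>
    have : u • c • x = c • u • x := map_zsmul (DistribSMul.toAddMonoidHom (Dual ℂ H) u) c x
    rw [this]
    exact Submodule.smul_mem _ c hx

end Combinatorics

/-! ### Transport of highest weight modules along automorphisms -/

section Transport

attribute [local instance 100] LieRing.ofAssociativeRing

variable {L : Type*} [LieRing L] [LieAlgebra ℂ L]

lemma enveloping_hom_ext {A : Type*} [Ring A] [Algebra ℂ A]
    {φ ψ : UniversalEnvelopingAlgebra ℂ L →ₐ[ℂ] A}
    (h : ∀ x, φ (UniversalEnvelopingAlgebra.ι ℂ x) = ψ (UniversalEnvelopingAlgebra.ι ℂ x)) :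
    φ = ψ :=
  UniversalEnvelopingAlgebra.hom_ext ℂ (LieHom.ext h)

/-- The endomorphism of `U(L)` extending an endomorphism of `L`. -/
def envelopingMap (θ : L →ₗ⁅ℂ⁆ L) :
    UniversalEnvelopingAlgebra ℂ L →ₐ[ℂ] UniversalEnvelopingAlgebra ℂ L :=
  UniversalEnvelopingAlgebra.lift ℂ ((UniversalEnvelopingAlgebra.ι ℂ).comp θ)

lemma envelopingMap_ι (θ : L →ₗ⁅ℂ⁆ L) (x : L) :
    envelopingMap θ (UniversalEnvelopingAlgebra.ι ℂ x) =
      UniversalEnvelopingAlgebra.ι ℂ (θ x) :=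
  UniversalEnvelopingAlgebra.lift_ι_apply ℂ _ x

/-- The automorphism of `U(L)` extending an automorphism of `L`. -/
def envelopingEquiv (θ : L ≃ₗ⁅ℂ⁆ L) :
    UniversalEnvelopingAlgebra ℂ L ≃ₐ[ℂ] UniversalEnvelopingAlgebra ℂ L :=
  AlgEquiv.ofAlgHom (envelopingMap θ.toLieHom) (envelopingMap θ.symm.toLieHom)
    (enveloping_hom_ext fun x => by
      rw [AlgHom.comp_apply, envelopingMap_ι, envelopingMap_ι, AlgHom.id_apply]
      exact congrArg _ (θ.apply_symm_apply x))
    (enveloping_hom_ext fun x => by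
      rw [AlgHom.comp_apply, envelopingMap_ι, envelopingMap_ι, AlgHom.id_apply]
      exact congrArg _ (θ.symm_apply_apply x))

lemma envelopingEquiv_ι (θ : L ≃ₗ⁅ℂ⁆ L) (x : L) :
    envelopingEquiv θ (UniversalEnvelopingAlgebra.ι ℂ x) = UniversalEnvelopingAlgebra.ι ℂ (θ x) :=
  envelopingMap_ι θ.toLieHom x

lemma envelopingEquiv_symm_ι (θ : L ≃ₗ⁅ℂ⁆ L) (x : L) :
    (envelopingEquiv θ).symm (UniversalEnvelopingAlgebra.ι ℂ x) =
      UniversalEnvelopingAlgebra.ι ℂ (θ.symm x) :=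
  envelopingMap_ι θ.symm.toLieHom x

/-- `U(L)` is generated by `L` as an algebra. -/
lemma enveloping_induction {p : UniversalEnvelopingAlgebra ℂ L → Prop}
    (algebraMap : ∀ c, p (algebraMap ℂ _ c)) (ι : ∀ x, p (UniversalEnvelopingAlgebra.ι ℂ x))
    (mul : ∀ x y, p x → p y → p (x * y)) (add : ∀ x y, p x → p y → p (x + y))
    (y : UniversalEnvelopingAlgebra ℂ L) : p y := by
  let S : Subalgebra ℂ (UniversalEnvelopingAlgebra ℂ L) :=
    { carrier := {y | p y}
      mul_mem' := fun hx hy => mul _ _ hx hy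
      add_mem' := fun hx hy => add _ _ hx hy
      algebraMap_mem' := algebraMap }
  let f : L →ₗ⁅ℂ⁆ S :=
    { toFun := fun x => ⟨UniversalEnvelopingAlgebra.ι ℂ x, ι x⟩
      map_add' := fun x y => Subtype.ext (map_add _ x y)
      map_smul' := fun c x => Subtype.ext (map_smul _ c x)
      map_lie' := fun {x y} => Subtype.ext (enveloping_lie x y) }
  have h : S.val.comp (UniversalEnvelopingAlgebra.lift ℂ f) = AlgHom.id ℂ _ :=
    enveloping_hom_ext fun x => by
      rw [AlgHom.comp_apply, UniversalEnvelopingAlgebra.lift_ι_apply]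
      rfl
  have h' := DFunLike.congr_fun h y
  rw [AlgHom.comp_apply, AlgHom.id_apply] at h'
  rw [← h']
  exact (UniversalEnvelopingAlgebra.lift ℂ f y).2

variable {t : Type*} [LieRing t] [LieAlgebra ℂ t]
  (j : t →ₗ⁅ℂ⁆ L) (N : Set L)

/-- An automorphism `θ` of `L` preserving the torus and the nilradical induces a map of irreducible
highest weight modules, semilinear with respect to `θ`, provided it matches the highest weights. -/
lemma exists_irreducibleModule_equiv (θ : L ≃ₗ⁅ℂ⁆ L) (τ : t ≃ₗ[ℂ] t)
    (hj : ∀ h, θ (j h) = j (τ h)) (hN : θ '' N = N) {lam lam' : Dual ℂ t}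
    (hlam : ∀ h, lam' (τ h) = lam h) :
    ∃ ψ : IrreducibleModule L j N lam ≃ₗ[ℂ] IrreducibleModule L j N lam',
      ∀ (x : L) (m : IrreducibleModule L j N lam), ψ ⁅x, m⁆ = ⁅θ x, ψ m⁆ := by
  let e := envelopingEquiv θ
  let σ : UniversalEnvelopingAlgebra ℂ L →+* UniversalEnvelopingAlgebra ℂ L :=
    e.toRingEquiv.toRingHom
  let σ' : UniversalEnvelopingAlgebra ℂ L →+* UniversalEnvelopingAlgebra ℂ L :=
    e.symm.toRingEquiv.toRingHom
  let _ : RingHomInvPair σ σ' :=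
    ⟨RingHom.ext e.symm_apply_apply, RingHom.ext e.apply_symm_apply⟩
  let _ : RingHomInvPair σ' σ := RingHomInvPair.symm _ _
  let E : UniversalEnvelopingAlgebra ℂ L ≃ₛₗ[σ] UniversalEnvelopingAlgebra ℂ L :=
    { e with
      map_smul' := fun c x => map_mul e c x }
  have hE (y) : E y = envelopingEquiv θ y := rfl
  have hideal : (vermaIdeal L j N lam).map E.toLinearMap = vermaIdeal L j N lam' := by
    rw [vermaIdeal, vermaIdeal, Submodule.map_span]
    congr 1
    rw [Set.image_union]
    congr 1
    · ext y
      constructor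
      · rintro ⟨_, ⟨x, hx, rfl⟩, rfl⟩
        exact ⟨θ x, hN ▸ ⟨x, hx, rfl⟩, envelopingEquiv_ι θ x⟩
      · rintro ⟨x, hx, rfl⟩
        rw [← hN] at hx
        obtain ⟨x, hx, rfl⟩ := hx
        exact ⟨_, ⟨x, hx, rfl⟩, envelopingEquiv_ι θ x⟩
    · have hgen (h : t) : E (UniversalEnvelopingAlgebra.ι ℂ (j h) - algebraMap ℂ _ (lam h)) =
          UniversalEnvelopingAlgebra.ι ℂ (j (τ h)) - algebraMap ℂ _ (lam' (τ h)) := by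
        rw [hE, map_sub, envelopingEquiv_ι, hj, hlam, AlgEquiv.commutes]
      ext y
      constructor
      · rintro ⟨_, ⟨h, rfl⟩, rfl⟩
        exact ⟨τ h, hgen h⟩
      · rintro ⟨h, rfl⟩
        refine ⟨_, ⟨τ.symm h, rfl⟩, (hgen _).trans ?_⟩
        rw [τ.apply_symm_apply]
  let F : VermaModule L j N lam ≃ₛₗ[σ] VermaModule L j N lam' :=
    Submodule.Quotient.equiv _ _ E hideal
  have hrad : (vermaRadical L j N lam).map F.toLinearMap = vermaRadical L j N lam' := by
    apply le_antisymm
    · refine Submodule.map_le_iff_le_comap.2 (sSup_le fun W hW => ?_)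
      refine Submodule.map_le_iff_le_comap.1 (le_sSup fun h => hW ?_)
      rw [← Submodule.comap_map_eq_of_injective F.injective W]
      exact (congrArg (Submodule.comap F.toLinearMap) h).trans (Submodule.comap_top _)
    · refine sSup_le fun W hW => ?_
      rw [← Submodule.map_comap_eq_of_surjective F.surjective W]
      refine Submodule.map_mono (le_sSup fun h => hW ?_)
      rw [← Submodule.map_comap_eq_of_surjective F.surjective W]
      refine (congrArg (Submodule.map F.toLinearMap) h).trans ?_
      rw [Submodule.map_top]
      exact LinearEquiv.range F
  let G : IrreducibleModule L j N lam ≃ₛₗ[σ] IrreducibleModule L j N lam' :=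
    Submodule.Quotient.equiv _ _ F hrad
  refine ⟨{ G with map_smul' := fun c m => ?_ }, fun x m => ?_⟩
  · change G (c • m) = c • G m
    rw [← algebraMap_smul (UniversalEnvelopingAlgebra ℂ L) c m,
      ← algebraMap_smul (UniversalEnvelopingAlgebra ℂ L) c (G m)]
    refine (G.map_smulₛₗ _ _).trans (congrArg (· • G m) ?_)
    exact (envelopingEquiv θ).commutes c
  · change G (UniversalEnvelopingAlgebra.ι ℂ x • m) = UniversalEnvelopingAlgebra.ι ℂ (θ x) • G m
    refine (G.map_smulₛₗ _ _).trans (congrArg (· • G m) ?_)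
    exact envelopingEquiv_ι θ x

end Transport

/-! ### Lifting Weyl group elements to automorphisms acting on integrable modules -/

section Lift

/-- `exp x` on `M` intertwines the action of `y` with that of `exp (ad x) y`. -/
lemma expSum_lie {g : Type*} [LieRing g] [LieAlgebra ℂ g] {M : Type*} [AddCommGroup M] [Module ℂ M]
    [LieRingModule g M] [LieModule ℂ g M] {x : g}
    (hx : IsLocallyNilpotent (LieModule.toEnd ℂ g g x))
    (hM : IsLocallyNilpotent (LieModule.toEnd ℂ g M x)) (y : g) (m : M) :
    expSum (LieModule.toEnd ℂ g M x) ⁅y, m⁆ =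
      ⁅expSum (LieModule.toEnd ℂ g g x) y, expSum (LieModule.toEnd ℂ g M x) m⁆ :=
  expSum_bilinear (LieModule.toEnd ℂ g M : g →ₗ[ℂ] End ℂ M) (fun y m => leibniz_lie x y m) hx hM y m

/-- The automorphism `exp (ad x)` of the Lie algebra. -/
def expAd {g : Type*} [LieRing g] [LieAlgebra ℂ g] {x : g}
    (hx : IsLocallyNilpotent (LieModule.toEnd ℂ g g x)) : g ≃ₗ⁅ℂ⁆ g :=
  { locExp hx with map_lie' := fun {y z} => expSum_lie hx hx y z }

universe u

variable {g : Type u} [LieRing g] [LieAlgebra ℂ g] [FiniteDimensional ℂ g] [IsKilling ℂ g]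
  {H : LieSubalgebra ℂ g} [H.IsCartanSubalgebra] (b : (rootSystem H).Base)

omit [IsKilling ℂ g] in
lemma root_isNonZero (i : H.root) : i.1.IsNonZero := by
  simpa only [LieSubalgebra.root, Finset.mem_filter, Finset.mem_univ, true_and] using i.2

/-- A `g`-module is integrable if the root vectors of the simple roots and of their negatives act
locally nilpotently. -/
def IsIntegrable (M : Type*) [AddCommGroup M] [Module ℂ M]
    [LieRingModule g M] [LieModule ℂ g M] : Prop :=
  ∀ i ∈ b.support, ∀ x : g,
    x ∈ rootSpace H (i.1 : H → ℂ) ∨ x ∈ rootSpace H (-(i.1 : H → ℂ)) →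
      IsLocallyNilpotent (LieModule.toEnd ℂ g M x)

/-- The automorphism `θ` of `g` is implemented on every integrable `g`-module `M`: the twist of `M`
by `θ` is isomorphic to `M`. It suffices to let `M` range over the universe of `g`, where `U(g)` and
its modules below live. -/
def IsImplemented (θ : g ≃ₗ⁅ℂ⁆ g) : Prop :=
  ∀ (M : Type u) [AddCommGroup M] [Module ℂ M] [LieRingModule g M] [LieModule ℂ g M],
    IsIntegrable b M → ∃ Θ : M ≃ₗ[ℂ] M, ∀ (x : g) (m : M), Θ ⁅x, m⁆ = ⁅θ x, Θ m⁆

variable {b} in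
lemma IsImplemented.trans {θ₁ θ₂ : g ≃ₗ⁅ℂ⁆ g} (h₁ : IsImplemented b θ₁)
    (h₂ : IsImplemented b θ₂) : IsImplemented b (θ₁.trans θ₂) := by
  intro M _ _ _ _ hM
  obtain ⟨Θ₁, hΘ₁⟩ := h₁ M hM
  obtain ⟨Θ₂, hΘ₂⟩ := h₂ M hM
  refine ⟨Θ₁.trans Θ₂, fun x m => ?_⟩
  rw [LinearEquiv.trans_apply, LinearEquiv.trans_apply, hΘ₁, hΘ₂]
  rfl

lemma isImplemented_expAd {i : H.root} (hi : i ∈ b.support) {x : g}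
    (hx : x ∈ rootSpace H (i.1 : H → ℂ) ∨ x ∈ rootSpace H (-(i.1 : H → ℂ)))
    (hx' : IsLocallyNilpotent (LieModule.toEnd ℂ g g x)) : IsImplemented b (expAd hx') :=
  fun _ _ _ _ _ hM => ⟨locExp (hM i hi x hx), expSum_lie hx' (hM i hi x hx)⟩

/-- For an `sl₂`-triple `(h, e, f)` of a simple root, `exp (ad e) exp (- ad f) exp (ad e)` acts on
the Cartan subalgebra as the simple reflection. -/
lemma exists_isImplemented_coreflection {i : H.root} (hi : i ∈ b.support) :
    ∃ θ : g ≃ₗ⁅ℂ⁆ g, IsImplemented b θ ∧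
      ∀ h : H, θ h = ((rootSystem H).coreflection i h : H) := by
  have hi0 := root_isNonZero i
  obtain ⟨c, e, f, ht, he, hf⟩ := exists_isSl2Triple_of_weight_isNonZero hi0
  have hc := ht.h_eq_coroot hi0 he hf
  have hne : (i.1 : H → ℂ) ≠ 0 := hi0
  -- `-f` is made opaque, so that `simp` does not move the sign out of the brackets
  obtain ⟨f', hff⟩ : ∃ f', f' = -f := ⟨_, rfl⟩
  have hf' : f' ∈ rootSpace H (-(i.1 : H → ℂ)) := hff ▸ neg_mem hf
  have he1 := IsLocallyNilpotent.of_isNilpotent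
    (LieModule.isNilpotent_toEnd_of_mem_rootSpace (M := g) H hne he)
  have hf1 := IsLocallyNilpotent.of_isNilpotent
    (LieModule.isNilpotent_toEnd_of_mem_rootSpace (M := g) H (neg_ne_zero.2 hne) hf')
  refine ⟨((expAd he1).trans (expAd hf1)).trans (expAd he1),
    ((isImplemented_expAd b hi (.inl he) he1).trans
      (isImplemented_expAd b hi (.inr hf') hf1)).trans (isImplemented_expAd b hi (.inl he) he1),
    fun h => ?_⟩
  have hhe (h : H) : ⁅e, (h : g)⁆ = -(i.1 h • e) := by
    rw [← lie_skew, ← lie_eq_smul_of_mem_rootSpace he h]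
    rfl
  have hhf (h : H) : ⁅f', (h : g)⁆ = -(i.1 h • f) := by
    have := lie_eq_smul_of_mem_rootSpace hf h
    rw [hff, neg_lie, lie_skew]
    rw [Pi.neg_apply, neg_smul] at this
    exact this
  have hfe : ⁅f', e⁆ = c := by rw [hff, neg_lie, lie_skew, ht.lie_e_f]
  have hfc : ⁅f', c⁆ = -((2 : ℂ) • f) := by rw [hff, neg_lie, lie_skew, ht.lie_lie_smul_f ℂ]
  have Eh (h : H) : expAd he1 (h : g) = h - i.1 h • e := by
    refine (expSum_eq (N := 2) (by simp [pow_two, hhe])).trans ?_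
    simp [Finset.sum_range_succ, hhe, sub_eq_add_neg]
  have Ee : expAd he1 e = e := by
    refine (expSum_eq (N := 1) (by simp)).trans ?_
    simp
  have hf'f : ⁅f', f⁆ = 0 := by rw [hff, neg_lie, lie_self, neg_zero]
  have Fh (h : H) : expAd hf1 (h : g) = h - i.1 h • f := by
    refine (expSum_eq (N := 2) (by simp [pow_two, hhf, hf'f])).trans ?_
    simp [Finset.sum_range_succ, hhf, sub_eq_add_neg]
  have Fe : expAd hf1 e = e + c - f := by
    refine (expSum_eq (N := 3) (by simp [pow_succ, hfe, hfc, hf'f])).trans ?_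
    simp only [Finset.sum_range_succ, Finset.range_zero, Finset.sum_empty, pow_succ, pow_zero,
      one_mul, Module.End.mul_apply, Module.End.one_apply, LieModule.toEnd_apply_apply, hfe, hfc,
      Nat.factorial]
    push_cast
    module
  have h2 : i.1 (coroot i.1) = 2 := root_apply_coroot hi0
  have hcor : ((rootSystem H).coreflection i h : H) = h - i.1 h • coroot i.1 := rfl
  rw [hcor]
  change expAd he1 (expAd hf1 (expAd he1 h)) = _
  rw [Eh, map_sub, map_smul, Fh, Fe, hc]
  have : (h : g) - i.1 h • f - i.1 h • (e + (coroot i.1 : H) - f) =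
      h - i.1 h • e - i.1 h • ((coroot i.1 : H) : g) := by module
  rw [this, map_sub, map_sub, map_smul, map_smul, Ee, Eh, Eh, h2]
  push_cast
  module

/-- The automorphism `θ` of `g` preserves the Cartan subalgebra and induces there the element `u` of
the Weyl group. -/
structure IsLift (θ : g ≃ₗ⁅ℂ⁆ g) (τ : H ≃ₗ[ℂ] H) (u : Dual ℂ H ≃ₗ[ℂ] Dual ℂ H) : Prop where
  apply_coe : ∀ h : H, θ h = τ h
  apply_apply : ∀ (χ : Dual ℂ H) (h : H), u χ (τ h) = χ h

omit [FiniteDimensional ℂ g] [IsKilling ℂ g] [H.IsCartanSubalgebra] in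
lemma IsLift.trans {θ₁ θ₂ : g ≃ₗ⁅ℂ⁆ g} {τ₁ τ₂ : H ≃ₗ[ℂ] H} {u₁ u₂ : Dual ℂ H ≃ₗ[ℂ] Dual ℂ H}
    (h₁ : IsLift θ₁ τ₁ u₁) (h₂ : IsLift θ₂ τ₂ u₂) :
    IsLift (θ₁.trans θ₂) (τ₁.trans τ₂) (u₂ * u₁) where
  apply_coe h := by
    change θ₂ (θ₁ h) = _
    rw [h₁.apply_coe, h₂.apply_coe]
    rfl
  apply_apply χ h := by
    change u₂ (u₁ χ) (τ₂ (τ₁ h)) = _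
    rw [h₂.apply_apply, h₁.apply_apply]

omit [FiniteDimensional ℂ g] [IsKilling ℂ g] [H.IsCartanSubalgebra] in
lemma IsLift.symm {θ : g ≃ₗ⁅ℂ⁆ g} {τ : H ≃ₗ[ℂ] H} {u : Dual ℂ H ≃ₗ[ℂ] Dual ℂ H}
    (h : IsLift θ τ u) : IsLift θ.symm τ.symm u⁻¹ where
  apply_coe x := by
    have := h.apply_coe (τ.symm x)
    rw [τ.apply_symm_apply] at this
    rw [← this]
    exact θ.symm_apply_apply _
  apply_apply χ x := by
    have := h.apply_apply (u⁻¹ χ) (τ.symm x)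
    rw [τ.apply_symm_apply] at this
    rw [← this]
    exact congrArg (· x) (u.apply_symm_apply χ)

/-- A lift of `u` maps the root space of `χ` to that of `u χ`. -/
lemma IsLift.mem_rootSpace {θ : g ≃ₗ⁅ℂ⁆ g} {τ : H ≃ₗ[ℂ] H} {u : Dual ℂ H ≃ₗ[ℂ] Dual ℂ H}
    (h : IsLift θ τ u) {χ : Dual ℂ H} {x : g} (hx : x ∈ rootSpace H (χ : H → ℂ)) :
    θ x ∈ rootSpace H (u χ : H → ℂ) := by
  refine LieModule.weightSpace_le_genWeightSpace g _ ((LieModule.mem_weightSpace _ _).2 fun y => ?_)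
  obtain ⟨y, rfl⟩ := τ.surjective y
  rw [h.apply_apply]
  change ⁅((τ y : H) : g), θ x⁆ = _
  rw [← h.apply_coe, ← LieEquiv.map_lie, ← map_smul]
  exact congrArg θ (lie_eq_smul_of_mem_rootSpace hx y)

lemma exists_isLift_simple_reflection {i : H.root} (hi : i ∈ b.support) :
    ∃ θ τ, IsLift θ τ ((rootSystem H).reflection i) ∧ IsImplemented b θ := by
  obtain ⟨θ, hθ, hθ'⟩ := exists_isImplemented_coreflection b hi
  refine ⟨θ, (rootSystem H).coreflection i, ⟨hθ', fun χ h => ?_⟩, hθ⟩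
  have h2 : (rootSystem H).root i ((rootSystem H).coroot i) = 2 :=
    (rootSystem H).root_coroot_two i
  rw [RootPairing.reflection_apply, RootPairing.coreflection_apply]
  simp only [LinearMap.sub_apply, LinearMap.smul_apply, map_sub, map_smul, smul_eq_mul, h2,
    rootSystem_toLinearMap_apply, LinearMap.flip_apply, RootPairing.root', RootPairing.coroot']
  ring

/-- The reflection in an arbitrary root is conjugate to a simple one by simple reflections, so only
simple root vectors need to act locally nilpotently. -/
lemma exists_isLift_reflection (i : H.root) :
    ∃ θ τ, IsLift θ τ ((rootSystem H).reflection i) ∧ IsImplemented b θ := by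
  -- the reflections in a root and in its negative agree
  have hneg (i : H.root) : (rootSystem H).reflection ((rootSystem H).reflectionPerm i i) =
      (rootSystem H).reflection i := by
    rw [RootPairing.reflection_reflectionPerm, mul_assoc, mul_eq_left]
    ext x
    simp
  induction i using b.induction_reflect with
  | h₀ i hi => rwa [hneg]
  | h₁ i hi => exact exists_isLift_simple_reflection b hi
  | h₂ i j hi hj =>
    obtain ⟨θ₁, τ₁, h₁, h₁'⟩ := hi
    obtain ⟨θ₂, τ₂, h₂, h₂'⟩ := exists_isLift_simple_reflection b hj
    rw [RootPairing.reflection_reflectionPerm, mul_assoc]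
    exact ⟨_, _, (h₂.trans h₁).trans h₂, (h₂'.trans h₁').trans h₂'⟩

lemma isImplemented_refl : IsImplemented b (LieEquiv.refl : g ≃ₗ⁅ℂ⁆ g) :=
  fun _ _ _ _ _ _ => ⟨LinearEquiv.refl ℂ _, fun _ _ => rfl⟩

/-- Every element of the Weyl group lifts to an automorphism of `g` that is implemented on all
integrable modules. -/
lemma exists_isLift (u : (rootSystem H).weylGroup) :
    ∃ θ τ, IsLift θ τ (RootPairing.Equiv.weightHom _ (u : (rootSystem H).Aut)) ∧
      IsImplemented b θ := by
  obtain ⟨u, hu⟩ := u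
  induction hu using RootPairing.weylGroup.induction with
  | mem i =>
    obtain ⟨θ, τ, h, h'⟩ := exists_isLift_reflection b i
    exact ⟨θ, τ, ⟨h.apply_coe, h.apply_apply⟩, h'⟩
  | one =>
    exact ⟨LieEquiv.refl, LinearEquiv.refl ℂ H, ⟨fun _ => rfl, fun _ _ => rfl⟩,
      isImplemented_refl b⟩
  | mul x y _ _ hx hy =>
    obtain ⟨θ₁, τ₁, h₁, h₁'⟩ := hx
    obtain ⟨θ₂, τ₂, h₂, h₂'⟩ := hy
    have h := h₂.trans h₁
    rw [← map_mul] at h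
    exact ⟨_, _, h, h₂'.trans h₁'⟩

end Lift

/-! ### Integrability -/

section LocallyNilpotentPart

variable {g : Type*} [LieRing g] [LieAlgebra ℂ g] (M : Type*) [AddCommGroup M] [Module ℂ M]
  [LieRingModule g M] [LieModule ℂ g M]

/-- The vectors of `M` killed by a power of an ad-nilpotent element `x`; by the Leibniz rule they
form a submodule. -/
def locallyNilpotentPart {x : g} (hx : IsLocallyNilpotent (LieModule.toEnd ℂ g g x)) :
    LieSubmodule ℂ g M where
  __ := (LieModule.toEnd ℂ g M x).maxGenEigenspace 0
  lie_mem {y m} hm := by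
    have hy : y ∈ (LieModule.toEnd ℂ g g x).maxGenEigenspace 0 := by
      rw [Module.End.mem_maxGenEigenspace]
      simpa using hx y
    have := LieModule.lie_mem_maxGenEigenspace_toEnd hy hm
    rwa [add_zero] at this

lemma mem_locallyNilpotentPart {x : g} {hx : IsLocallyNilpotent (LieModule.toEnd ℂ g g x)}
    {m : M} :
    m ∈ locallyNilpotentPart M hx ↔ ∃ k : ℕ, (LieModule.toEnd ℂ g M x ^ k) m = 0 := by
  change m ∈ (LieModule.toEnd ℂ g M x).maxGenEigenspace 0 ↔ _
  rw [Module.End.mem_maxGenEigenspace]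
  simp

end LocallyNilpotentPart

section Integrable

variable {g : Type*} [LieRing g] [LieAlgebra ℂ g] [FiniteDimensional ℂ g] [IsKilling ℂ g]
  {H : LieSubalgebra ℂ g} [H.IsCartanSubalgebra] (b : (rootSystem H).Base)

omit [IsKilling ℂ g] in
lemma isLocallyNilpotent_toEnd_of_mem_rootSpace {i : H.root} {x : g}
    (hx : x ∈ rootSpace H (i.1 : H → ℂ) ∨ x ∈ rootSpace H (-(i.1 : H → ℂ)))
    (M : Type*) [AddCommGroup M] [Module ℂ M] [LieRingModule g M] [LieModule ℂ g M]
    [FiniteDimensional ℂ M] :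
    IsLocallyNilpotent (LieModule.toEnd ℂ g M x) := by
  have hi0 : (i.1 : H → ℂ) ≠ 0 := root_isNonZero i
  refine .of_isNilpotent ?_
  rcases hx with hx | hx
  · exact LieModule.isNilpotent_toEnd_of_mem_rootSpace M H hi0 hx
  · exact LieModule.isNilpotent_toEnd_of_mem_rootSpace M H (neg_ne_zero.2 hi0) hx

/-- Root vectors act nilpotently on each finite-dimensional submodule, and the vectors killed by
a power of a given one form a submodule. -/
lemma isIntegrable_sSup_finiteDimensional (M : Type*) [AddCommGroup M] [Module ℂ M]
    [LieRingModule g M] [LieModule ℂ g M] :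
    IsIntegrable b ↥(sSup {W : LieSubmodule ℂ g M | FiniteDimensional ℂ W}) := by
  intro i _ x hx m
  have hle : sSup {W : LieSubmodule ℂ g M | FiniteDimensional ℂ W} ≤
      locallyNilpotentPart M (isLocallyNilpotent_toEnd_of_mem_rootSpace hx g) := by
    refine sSup_le fun W (hW : FiniteDimensional ℂ W) m hm => ?_
    obtain ⟨k, hk⟩ := isLocallyNilpotent_toEnd_of_mem_rootSpace hx W ⟨m, hm⟩
    refine (mem_locallyNilpotentPart M).2 ⟨k, ?_⟩
    have := congrArg Subtype.val hk
    rwa [LieSubmodule.coe_toEnd_pow] at this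
  obtain ⟨k, hk⟩ := (mem_locallyNilpotentPart M).1 (hle m.2)
  refine ⟨k, Subtype.ext ?_⟩
  rwa [LieSubmodule.coe_toEnd_pow]

/-- The vectors obtained from `w` by applying negative root vectors repeatedly. -/
inductive IsLowering {M : Type*} [AddCommGroup M] [LieRingModule g M] (w : M) : M → Prop
  | base : IsLowering w w
  | step (j : H.root) (hj : b.IsPos j) (y : g) (hy : y ∈ rootSpace H (-(j.1 : H → ℂ))) (m : M)
      (hm : IsLowering w m) : IsLowering w ⁅y, m⁆

/-- A subspace of `g` containing the Cartan subalgebra and all root vectors is everything. -/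
lemma mem_of_rootSpace_le {S : Submodule ℂ g} (hH : ∀ h : H, (h : g) ∈ S)
    (hpos : ∀ j : H.root, b.IsPos j → ∀ x ∈ rootSpace H (j.1 : H → ℂ), x ∈ S)
    (hneg : ∀ j : H.root, b.IsPos j → ∀ x ∈ rootSpace H (-(j.1 : H → ℂ)), x ∈ S) (x : g) :
    x ∈ S := by
  have hx : x ∈ ⨆ χ : LieModule.Weight ℂ H g, LieModule.genWeightSpace g χ := by
    simp [LieModule.iSup_genWeightSpace_eq_top' ℂ H g]
  induction hx using LieSubmodule.iSup_induction' with
  | zero => exact zero_mem S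
  | add x y _ _ hx hy => exact add_mem hx hy
  | mem χ x hx =>
    by_cases hχ : χ.IsZero
    · have h0 : (χ : H → ℂ) = 0 := hχ
      rw [h0] at hx
      have hx' : x ∈ rootSpace H (0 : H → ℂ) := hx
      rw [LieAlgebra.rootSpace_zero_eq] at hx'
      exact hH ⟨x, hx'⟩
    · let i : H.root := ⟨χ, by
        simpa only [LieSubalgebra.root, Finset.mem_filter, Finset.mem_univ, true_and] using hχ⟩
      let := (rootSystem H).indexNeg
      rcases RootPairing.Base.IsPos.or_neg b i with hi | hi
      · exact hpos i hi x hx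
      · refine hneg _ hi x ?_
        have h1 : (rootSystem H).root (-i) = -(rootSystem H).root i := by
          simp only [RootPairing.indexNeg_neg, RootPairing.root_reflectionPerm,
            RootPairing.reflection_apply_self]
        have h2 : -((-i : H.root).1 : H → ℂ) = χ := by
          ext h
          have h3 := LinearMap.congr_fun h1 h
          rw [Pi.neg_apply, neg_eq_iff_eq_neg]
          exact h3
        rw [h2]
        exact hx

/-- The submodule generated by a singular vector `w` of weight `mu` has its weights below `mu`, so
that it contains no vector of any other degree. -/
lemma exists_submodule_of_singular (M : Type*) [AddCommGroup M] [Module ℂ M]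
    [LieRingModule g M] [LieModule ℂ g M] {w : M} {mu : Dual ℂ H}
    (hwt : ∀ h : H, ⁅(h : g), w⁆ = mu h • w)
    (hsing : ∀ j : H.root, b.IsPos j → ∀ x ∈ rootSpace H (j.1 : H → ℂ), ⁅x, w⁆ = 0)
    {h₀ : H} (hh₀ : ∀ i : H.root, (rootSystem H).root i h₀ = b.height i) :
    ∃ D : LieSubmodule ℂ g M, w ∈ D ∧ ∀ v ∈ D, ∀ c : ℂ, ⁅(h₀ : g), v⁆ = c • v →
      (∀ k : ℕ, c ≠ mu h₀ - k) → v = 0 := by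
  have hlow (j : H.root) (hj : b.IsPos j) (y : g) (hy : y ∈ rootSpace H (-(j.1 : H → ℂ))) (m : M)
      (hm : m ∈ Submodule.span ℂ {m | IsLowering b w m}) :
      ⁅y, m⁆ ∈ Submodule.span ℂ {m | IsLowering b w m} := by
    induction hm using Submodule.span_induction with
    | mem m hm => exact Submodule.subset_span (IsLowering.step j hj y hy m hm)
    | zero => simp
    | add m m' _ _ h h' => simpa using add_mem h h'
    | smul c m _ h => simpa using Submodule.smul_mem _ c h
  have hlie (m : M) (hm : IsLowering b w m) (x : g) :
      ⁅x, m⁆ ∈ Submodule.span ℂ {m | IsLowering b w m} := by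
    induction hm generalizing x with
    | base =>
      refine mem_of_rootSpace_le b (S := (Submodule.span ℂ {m | IsLowering b w m}).comap
        ((LieModule.toEnd ℂ g M : g →ₗ[ℂ] End ℂ M).flip w)) ?_ ?_ ?_ x
      · intro h
        change ⁅(h : g), w⁆ ∈ Submodule.span ℂ {m | IsLowering b w m}
        rw [hwt]
        exact Submodule.smul_mem _ _ (Submodule.subset_span IsLowering.base)
      · intro j hj x hx
        change ⁅x, w⁆ ∈ Submodule.span ℂ {m | IsLowering b w m}
        rw [hsing j hj x hx]
        exact zero_mem _
      · intro j hj x hx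
        exact Submodule.subset_span (IsLowering.step j hj x hx w IsLowering.base)
    | step j hj y hy m hm ih =>
      rw [leibniz_lie]
      exact add_mem (ih _) (hlow j hj y hy _ (ih x))
  refine ⟨{ Submodule.span ℂ {m | IsLowering b w m} with lie_mem := ?_ },
    Submodule.subset_span IsLowering.base, ?_⟩
  · intro x m hm
    change m ∈ Submodule.span ℂ {m | IsLowering b w m} at hm
    change ⁅x, m⁆ ∈ Submodule.span ℂ {m | IsLowering b w m}
    induction hm using Submodule.span_induction with
    | mem m hm => exact hlie m hm x
    | zero => simp
    | add m m' _ _ h h' => simpa using add_mem h h'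
    | smul c m _ h => simpa using Submodule.smul_mem _ c h
  · intro v hv c hc hck
    have hdeg (m : M) (hm : IsLowering b w m) :
        ∃ k : ℕ, ⁅(h₀ : g), m⁆ = (mu h₀ - k) • m := by
      induction hm with
      | base => exact ⟨0, by simp [hwt]⟩
      | step j hj y hy m hm ih =>
        obtain ⟨k, hk⟩ := ih
        rw [RootPairing.Base.isPos_iff] at hj
        obtain ⟨n, hn⟩ := Int.eq_ofNat_of_zero_le hj.le
        have hjn : (j.1 : H → ℂ) h₀ = n := by
          have := hh₀ j
          rw [hn, Int.cast_natCast] at this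
          exact this
        have hy' : ⁅(h₀ : g), y⁆ = -(n : ℂ) • y := by
          have := lie_eq_smul_of_mem_rootSpace hy h₀
          rwa [Pi.neg_apply, hjn] at this
        refine ⟨k + n, ?_⟩
        rw [leibniz_lie, hk, hy', smul_lie, lie_smul]
        push_cast
        module
    -- all degrees occurring in the submodule differ from `c`
    have hle : Submodule.span ℂ {m | IsLowering b w m} ≤
        ⨆ d ≠ c, (LieModule.toEnd ℂ g M (h₀ : g)).eigenspace d := by
      refine Submodule.span_le.2 fun m hm => ?_
      obtain ⟨k, hk⟩ := hdeg m hm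
      exact Submodule.mem_iSup_of_mem _ (Submodule.mem_iSup_of_mem (hck k).symm
        (Module.End.mem_eigenspace_iff.2 hk))
    exact Submodule.disjoint_def.1
      ((Module.End.eigenspaces_iSupIndep (LieModule.toEnd ℂ g M (h₀ : g))) c) v
      (Module.End.mem_eigenspace_iff.2 hc) (hle hv)

lemma exists_smul_of_mem_rootSpace {α : LieModule.Weight ℂ H g} (hα : α.IsNonZero) {x y : g}
    (hx : x ∈ rootSpace H (α : H → ℂ)) (hx0 : x ≠ 0) (hy : y ∈ rootSpace H (α : H → ℂ)) :
    ∃ c : ℂ, y = c • x := by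
  obtain ⟨c, hc⟩ := (finrank_eq_one_iff_of_nonzero' (⟨x, hx⟩ : rootSpace H (α : H → ℂ))
    (by rwa [ne_eq, LieSubmodule.mk_eq_zero])).1 (finrank_rootSpace_eq_one α hα) ⟨y, hy⟩
  exact ⟨c, (congrArg Subtype.val hc).symm⟩

/-- The bracket of a positive root vector and a negative simple root vector is zero or again a
positive root vector, unless the two roots are opposite. -/
lemma lie_negative_simple {i j : H.root} (hi : i ∈ b.support) (hj : b.IsPos j) (hij : j ≠ i)
    {x f : g} (hx : x ∈ rootSpace H (j.1 : H → ℂ)) (hf : f ∈ rootSpace H (-(i.1 : H → ℂ))) :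
    ⁅x, f⁆ = 0 ∨ ∃ k : H.root, b.IsPos k ∧ k ≠ i ∧ ⁅x, f⁆ ∈ rootSpace H (k.1 : H → ℂ) := by
  have hmem : ⁅x, f⁆ ∈ rootSpace H ((j.1 : H → ℂ) + -(i.1 : H → ℂ)) :=
    lie_mem_genWeightSpace_of_mem_genWeightSpace hx hf
  by_cases hbot : rootSpace H ((j.1 : H → ℂ) + -(i.1 : H → ℂ)) = ⊥
  · left
    rwa [hbot, LieSubmodule.mem_bot] at hmem
  · right
    let χ : LieModule.Weight ℂ H g := ⟨_, hbot⟩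
    have hχ : χ.IsNonZero := by
      intro h0
      have h1 : (j.1 : H → ℂ) + -(i.1 : H → ℂ) = 0 := h0
      rw [add_neg_eq_zero] at h1
      exact hij (Subtype.ext (DFunLike.coe_injective h1))
    let k : H.root := ⟨χ, by
      simpa only [LieSubalgebra.root, Finset.mem_filter, Finset.mem_univ, true_and] using hχ⟩
    have hk : (rootSystem H).root k = (rootSystem H).root j - (rootSystem H).root i := by
      ext h
      exact (sub_eq_add_neg _ _).symm
    refine ⟨k, hj.sub hi hk, ?_, hmem⟩
    intro hki
    have h1 : (j.1 : H → ℂ) = 2 • (i.1 : H → ℂ) := by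
      have h2 : (j.1 : H → ℂ) + -(i.1 : H → ℂ) = i.1 :=
        congrArg (fun k : H.root => (k.1 : H → ℂ)) hki
      rw [two_smul]
      exact add_neg_eq_iff_eq_add.1 h2
    have h2 := j.1.genWeightSpace_ne_bot
    rw [h1] at h2
    exact h2 (rootSpace_two_smul i.1 (root_isNonZero i))

/-- A module without proper submodules that is generated by a highest weight vector of dominant
integral weight is integrable. -/
lemma isIntegrable_of_highestWeight (M : Type*) [AddCommGroup M] [Module ℂ M]
    [LieRingModule g M] [LieModule ℂ g M] (hM : ∀ W : LieSubmodule ℂ g M, W = ⊥ ∨ W = ⊤)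
    {v : M} (hgen : ∀ W : LieSubmodule ℂ g M, v ∈ W → W = ⊤) {lam : Dual ℂ H}
    (hwt : ∀ h : H, ⁅(h : g), v⁆ = lam h • v)
    (hsing : ∀ j : H.root, b.IsPos j → ∀ x ∈ rootSpace H (j.1 : H → ℂ), ⁅x, v⁆ = 0)
    (hlam : ∀ i ∈ b.support, ∃ n : ℕ, lam ((rootSystem H).coroot i) = n) :
    IsIntegrable b M := by
  have hnil {x : g} (hx : IsLocallyNilpotent (LieModule.toEnd ℂ g g x)) (k : ℕ)
      (hk : (LieModule.toEnd ℂ g M x ^ k) v = 0) :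
      IsLocallyNilpotent (LieModule.toEnd ℂ g M x) := by
    intro m
    have htop := hgen (locallyNilpotentPart M hx) ((mem_locallyNilpotentPart M).2 ⟨k, hk⟩)
    exact (mem_locallyNilpotentPart M (hx := hx)).1 (htop ▸ LieSubmodule.mem_top m)
  intro i hi x hx
  have hx' := isLocallyNilpotent_toEnd_of_mem_rootSpace hx g
  rcases hx with hx | hx
  · refine hnil hx' 1 ?_
    rw [pow_one]
    exact hsing i (RootPairing.Base.isPos_of_mem_support hi) x hx
  obtain ⟨n, hn⟩ := hlam i hi
  refine hnil hx' (n + 1) ?_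
  obtain ⟨c, e, f, ht, he, hf⟩ := exists_isSl2Triple_of_weight_isNonZero (root_isNonZero i)
  have hc := ht.h_eq_coroot (root_isNonZero i) he hf
  obtain ⟨z, rfl⟩ := exists_smul_of_mem_rootSpace (α := -i.1) (by simpa using root_isNonZero i)
    (by simpa using hf) ht.f_ne_zero (by simpa using hx)
  -- `f ^ (n + 1)` applied to `v` is a singular vector, which cannot generate `v`
  suffices hw : (LieModule.toEnd ℂ g M f ^ (n + 1)) v = 0 by
    rw [map_smul, smul_pow, LinearMap.smul_apply, hw, smul_zero]
  obtain ⟨h₀, hh₀⟩ := exists_grading_element b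
  have hpow (k : ℕ) : (LieModule.toEnd ℂ g M f ^ (k + 1)) v =
      ⁅f, (LieModule.toEnd ℂ g M f ^ k) v⁆ := by
    rw [pow_succ', Module.End.mul_apply, LieModule.toEnd_apply_apply]
  have hwtk (k : ℕ) (h : H) : ⁅(h : g), (LieModule.toEnd ℂ g M f ^ k) v⁆ =
      (lam - (k : ℂ) • (rootSystem H).root i) h • (LieModule.toEnd ℂ g M f ^ k) v := by
    induction k with
    | zero => simp [hwt]
    | succ k ih =>
      have hf' : ⁅(h : g), f⁆ = -i.1 h • f := lie_eq_smul_of_mem_rootSpace hf h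
      rw [hpow, leibniz_lie, ih, hf', smul_lie, lie_smul, ← add_smul]
      congr 1
      simp only [LinearMap.sub_apply, LinearMap.smul_apply, rootSystem_root_apply, smul_eq_mul,
        LieModule.Weight.toLinear_apply]
      push_cast
      ring
  -- other positive root vectors kill the whole string, as bracketing with `f` preserves this set
  have hsingk (k : ℕ) : ∀ j : H.root, b.IsPos j → j ≠ i → ∀ x ∈ rootSpace H (j.1 : H → ℂ),
      ⁅x, (LieModule.toEnd ℂ g M f ^ k) v⁆ = 0 := by
    induction k with
    | zero => exact fun j hj _ x hx => hsing j hj x hx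
    | succ k ih =>
      intro j hj hji x hx
      rw [hpow, leibniz_lie, ih j hj hji x hx, lie_zero, add_zero]
      rcases lie_negative_simple b hi hj hji hx hf with h | ⟨l, hl, hli, hmem⟩
      · rw [h, zero_lie]
      · exact ih l hl hli _ hmem
  by_contra hw
  have hv : v ≠ 0 := by
    rintro rfl
    exact hw (map_zero _)
  have hprim : ht.HasPrimitiveVectorWith v (n : ℂ) := by
    refine ⟨hv, ?_, hsing i (RootPairing.Base.isPos_of_mem_support hi) e he⟩
    rw [hc, hwt, ← hn]
    rfl
  -- `e f ^ (n + 1) v = (n + 1) (n - n) f ^ n v`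
  have he0 : ⁅e, (LieModule.toEnd ℂ g M f ^ (n + 1)) v⁆ = 0 := by
    rw [hprim.lie_e_pow_succ_toEnd_f, sub_self, mul_zero, zero_smul]
  have hsing' : ∀ j : H.root, b.IsPos j → ∀ x ∈ rootSpace H (j.1 : H → ℂ),
      ⁅x, (LieModule.toEnd ℂ g M f ^ (n + 1)) v⁆ = 0 := by
    intro j hj x hx
    by_cases hji : j = i
    · rw [hji] at hx
      obtain ⟨a, rfl⟩ := exists_smul_of_mem_rootSpace (root_isNonZero i) he ht.e_ne_zero hx
      rw [smul_lie, he0, smul_zero]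
    · exact hsingk (n + 1) j hj hji x hx
  obtain ⟨D, hwD, hD⟩ := exists_submodule_of_singular b M (hwtk (n + 1)) hsing' hh₀
  have hDtop : D = ⊤ := (hM D).resolve_left fun hbot => hw (by rwa [hbot] at hwD)
  refine hv (hD v (hDtop ▸ LieSubmodule.mem_top v) _ (hwt h₀) fun k hk => ?_)
  rw [LinearMap.sub_apply, LinearMap.smul_apply, hh₀,
    RootPairing.Base.height_one_of_mem_support hi] at hk
  have h1 : ((n + 1 + k : ℕ) : ℂ) = 0 := by
    push_cast at hk ⊢
    rw [smul_eq_mul] at hk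
    linear_combination hk
  exact absurd (Nat.cast_eq_zero.1 h1) (by omega)

end Integrable

/-! ### The irreducible highest weight modules of dominant weight are integrable -/

section Irreducible

variable {L : Type*} [LieRing L] [LieAlgebra ℂ L] {t : Type*} [LieRing t] [LieAlgebra ℂ t]
  (j : t →ₗ⁅ℂ⁆ L) (N : Set L) (lam : Dual ℂ t)

/-- The image of `1 ∈ U(L)`, a highest weight vector. -/
def highestWeightVector : IrreducibleModule L j N lam :=
  Submodule.Quotient.mk (Submodule.Quotient.mk (1 : UniversalEnvelopingAlgebra ℂ L))

lemma smul_highestWeightVector_eq_zero {y : UniversalEnvelopingAlgebra ℂ L}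
    (hy : y ∈ vermaIdeal L j N lam) : y • highestWeightVector j N lam = 0 := by
  change Submodule.Quotient.mk (Submodule.Quotient.mk (y • 1)) = _
  rw [smul_eq_mul, mul_one, (Submodule.Quotient.mk_eq_zero _).2 hy]
  rfl

lemma lie_highestWeightVector_of_mem {x : L} (hx : x ∈ N) :
    ⁅x, highestWeightVector j N lam⁆ = 0 :=
  smul_highestWeightVector_eq_zero j N lam (Submodule.subset_span (.inl ⟨x, hx, rfl⟩))

lemma lie_highestWeightVector_torus (h : t) :
    ⁅j h, highestWeightVector j N lam⁆ = lam h • highestWeightVector j N lam := by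
  have := smul_highestWeightVector_eq_zero j N lam (Submodule.subset_span (.inr ⟨h, rfl⟩))
  rw [sub_smul, sub_eq_zero, algebraMap_smul] at this
  exact this

variable {j N lam} in
lemma enveloping_smul_mem (W : LieSubmodule ℂ L (IrreducibleModule L j N lam))
    (y : UniversalEnvelopingAlgebra ℂ L) {m : IrreducibleModule L j N lam} (hm : m ∈ W) :
    y • m ∈ W := by
  induction y using enveloping_induction generalizing m with
  | algebraMap c =>
    rw [algebraMap_smul]
    exact W.smul_mem c hm
  | ι x => exact W.lie_mem hm
  | mul x y hx hy =>
    rw [mul_smul]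
    exact hx (hy hm)
  | add x y hx hy =>
    rw [add_smul]
    exact add_mem (hx hm) (hy hm)

variable {j N lam} in
lemma eq_top_of_highestWeightVector_mem (W : LieSubmodule ℂ L (IrreducibleModule L j N lam))
    (hW : highestWeightVector j N lam ∈ W) : W = ⊤ := by
  refine eq_top_iff.2 fun m _ => ?_
  obtain ⟨m, rfl⟩ := Submodule.Quotient.mk_surjective _ m
  obtain ⟨y, rfl⟩ := Submodule.Quotient.mk_surjective _ m
  have h := enveloping_smul_mem W y hW
  change Submodule.Quotient.mk (Submodule.Quotient.mk (y • 1)) ∈ W at h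
  rwa [smul_eq_mul, mul_one] at h

variable {j N lam} in
/-- A submodule whose preimage in the Verma module is proper lies in the radical. -/
lemma irreducibleModule_eq_bot_or_eq_top
    (W : LieSubmodule ℂ L (IrreducibleModule L j N lam)) : W = ⊥ ∨ W = ⊤ := by
  let W' : Submodule (UniversalEnvelopingAlgebra ℂ L) (IrreducibleModule L j N lam) :=
    { W.toAddSubmonoid with smul_mem' := fun y _ hm => enveloping_smul_mem W y hm }
  let X : Submodule (UniversalEnvelopingAlgebra ℂ L) (VermaModule L j N lam) :=
    W'.comap (vermaRadical L j N lam).mkQ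
  by_cases hX : X = ⊤
  · right
    refine eq_top_of_highestWeightVector_mem W ?_
    have : Submodule.Quotient.mk (1 : UniversalEnvelopingAlgebra ℂ L) ∈ X := hX ▸ trivial
    exact this
  · left
    refine (LieSubmodule.eq_bot_iff _).2 fun m hm => ?_
    obtain ⟨m, rfl⟩ := Submodule.Quotient.mk_surjective _ m
    have hmX : m ∈ X := hm
    exact (Submodule.Quotient.mk_eq_zero _).2 (le_sSup (a := X) hX hmX)

variable {g : Type*} [LieRing g] [LieAlgebra ℂ g] [FiniteDimensional ℂ g] [IsKilling ℂ g]
  {H : LieSubalgebra ℂ g} [H.IsCartanSubalgebra] (b : (rootSystem H).Base)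

lemma isIntegrable_V {lam : Dual ℂ H} (hlam : lam ∈ dominantWeights (b.support : Set H.root)) :
    IsIntegrable b (V b lam) := by
  refine isIntegrable_of_highestWeight b _ irreducibleModule_eq_bot_or_eq_top
    eq_top_of_highestWeightVector_mem (lam := lam) ?_ ?_ hlam.2
  · exact fun h => lie_highestWeightVector_torus H.incl _ lam h
  · intro j hj x hx
    exact lie_highestWeightVector_of_mem _ _ _ ⟨_, ⟨j, hj, rfl⟩, hx⟩

end Irreducible

/-! ### Transport of coinduced and induced modules along automorphisms -/

section Induction

variable {g : Type*} [LieRing g] [LieAlgebra ℂ g]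

/-- The isomorphism is `φ ↦ ψ ∘ φ ∘ U(θ)⁻¹`. -/
lemma exists_coinduced_equiv {K : LieSubalgebra ℂ g}
    {N : Type*} [AddCommGroup N] [Module ℂ N] [LieRingModule K N] [LieModule ℂ K N]
    {N' : Type*} [AddCommGroup N'] [Module ℂ N'] [LieRingModule K N'] [LieModule ℂ K N']
    (θ : g ≃ₗ⁅ℂ⁆ g) (θK : K ≃ₗ⁅ℂ⁆ K) (hθ : ∀ x : K, θ x = θK x) (ψ : N ≃ₗ[ℂ] N')
    (hψ : ∀ (x : K) (m : N), ψ ⁅x, m⁆ = ⁅θK x, ψ m⁆) :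
    ∃ Φ : Coinduced K N ≃ₗ[ℂ] Coinduced K N', ∀ (z : g) (φ : Coinduced K N),
      Φ ⁅z, φ⁆ = ⁅θ z, Φ φ⁆ := by
  let e := (envelopingEquiv θ).toLinearEquiv
  let A : (UniversalEnvelopingAlgebra ℂ g →ₗ[ℂ] N) ≃ₗ[ℂ]
      (UniversalEnvelopingAlgebra ℂ g →ₗ[ℂ] N') := e.arrowCongr ψ
  have hA (φ y) : A φ y = ψ (φ ((envelopingEquiv θ).symm y)) := rfl
  have hψ' (x : K) (m : N') : ψ.symm ⁅θK x, m⁆ = ⁅x, ψ.symm m⁆ := by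
    rw [LinearEquiv.symm_apply_eq, hψ, ψ.apply_symm_apply]
  have hmap : (Coinduced K N).map A.toLinearMap = Coinduced K N' := by
    ext φ
    constructor
    · rintro ⟨φ, hφ, rfl⟩ x y
      obtain ⟨x, rfl⟩ : ∃ x', θK x' = x := ⟨θK.symm x, θK.apply_symm_apply x⟩
      change A φ _ = ⁅_, A φ y⁆
      rw [hA, hA, ← hψ, ← hφ x, map_mul, envelopingEquiv_symm_ι, ← hθ, LieEquiv.symm_apply_apply]
    · intro hφ
      refine ⟨A.symm φ, fun x y => ?_, A.apply_symm_apply φ⟩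
      change ψ.symm (φ (envelopingEquiv θ _)) = ⁅x, ψ.symm (φ (envelopingEquiv θ y))⁆
      rw [map_mul, envelopingEquiv_ι, hθ, hφ (θK x), hψ']
  refine ⟨A.ofSubmodules _ _ hmap, fun z φ => Subtype.ext (LinearMap.ext fun y => ?_)⟩
  change ψ (φ.1 ((envelopingEquiv θ).symm y * UniversalEnvelopingAlgebra.ι ℂ z)) =
    ψ (φ.1 ((envelopingEquiv θ).symm (y * UniversalEnvelopingAlgebra.ι ℂ (θ z))))
  rw [map_mul (envelopingEquiv θ).symm, envelopingEquiv_symm_ι, LieEquiv.symm_apply_apply]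

variable {M : Type*} [AddCommGroup M] [Module ℂ M] [LieRingModule g M]
  {M' : Type*} [AddCommGroup M'] [Module ℂ M'] [LieRingModule g M']

lemma semilinear_symm {θ : g ≃ₗ⁅ℂ⁆ g} {Φ : M ≃ₗ[ℂ] M'}
    (hΦ : ∀ (z : g) (m : M), Φ ⁅z, m⁆ = ⁅θ z, Φ m⁆) (z : g) (m : M') :
    Φ.symm ⁅z, m⁆ = ⁅θ.symm z, Φ.symm m⁆ := by
  rw [LinearEquiv.symm_apply_eq, hΦ, LieEquiv.apply_symm_apply, LinearEquiv.apply_symm_apply]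

/-- If the twist of `M` by `θ` is isomorphic both to `M` and to `M'`, then `M` and `M'` are
isomorphic. -/
lemma nonempty_lieModuleEquiv {θ : g ≃ₗ⁅ℂ⁆ g} {Θ : M ≃ₗ[ℂ] M} {Φ : M ≃ₗ[ℂ] M'}
    (hΘ : ∀ (z : g) (m : M), Θ ⁅z, m⁆ = ⁅θ z, Θ m⁆)
    (hΦ : ∀ (z : g) (m : M), Φ ⁅z, m⁆ = ⁅θ z, Φ m⁆) : Nonempty (M ≃ₗ⁅ℂ, g⁆ M') :=
  ⟨{ Θ.symm.trans Φ with
    map_lie' := fun {x m} => by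
      change Φ (Θ.symm ⁅x, m⁆) = ⁅x, Φ (Θ.symm m)⁆
      rw [semilinear_symm hΘ, hΦ, LieEquiv.apply_symm_apply] }⟩

/-- The isomorphism of the spaces of homomorphisms is `φ ↦ Θ ∘ φ ∘ ψ⁻¹`. -/
lemma finrank_lieModuleHom_eq
    {N : Type*} [AddCommGroup N] [Module ℂ N] [LieRingModule g N] [LieModule ℂ g N]
    {θ : g ≃ₗ⁅ℂ⁆ g} {ψ : M ≃ₗ[ℂ] M'} {Θ : N ≃ₗ[ℂ] N}
    (hψ : ∀ (z : g) (m : M), ψ ⁅z, m⁆ = ⁅θ z, ψ m⁆)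
    (hΘ : ∀ (z : g) (m : N), Θ ⁅z, m⁆ = ⁅θ z, Θ m⁆) :
    finrank ℂ (M →ₗ⁅ℂ, g⁆ N) = finrank ℂ (M' →ₗ⁅ℂ, g⁆ N) := by
  have hψ' := semilinear_symm hψ
  have hΘ' := semilinear_symm hΘ
  refine LinearEquiv.finrank_eq
    { toFun := fun φ =>
        { Θ.toLinearMap ∘ₗ φ.toLinearMap ∘ₗ ψ.symm.toLinearMap with
          map_lie' := fun {x m} => ?_ }
      map_add' := fun φ φ' => LieModuleHom.ext fun m => map_add Θ _ _
      map_smul' := fun c φ => LieModuleHom.ext fun m => map_smul Θ c _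
      invFun := fun φ =>
        { Θ.symm.toLinearMap ∘ₗ φ.toLinearMap ∘ₗ ψ.toLinearMap with
          map_lie' := fun {x m} => ?_ }
      left_inv := fun φ => LieModuleHom.ext fun m => ?_
      right_inv := fun φ => LieModuleHom.ext fun m => ?_ }
  · change Θ (φ (ψ.symm ⁅x, m⁆)) = ⁅x, Θ (φ (ψ.symm m))⁆
    rw [hψ', LieModuleHom.map_lie, hΘ, LieEquiv.apply_symm_apply]
  · change Θ.symm (φ (ψ ⁅x, m⁆)) = ⁅x, Θ.symm (φ (ψ m))⁆
    rw [hψ, LieModuleHom.map_lie, hΘ', LieEquiv.symm_apply_apply]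
  · change Θ.symm (Θ (φ (ψ.symm (ψ m)))) = φ m
    rw [Θ.symm_apply_apply, ψ.symm_apply_apply]
  · change Θ (Θ.symm (φ (ψ (ψ.symm m)))) = φ m
    rw [Θ.apply_symm_apply, ψ.apply_symm_apply]

/-- The preimage of a Lie submodule under a map semilinear with respect to `θ`. -/
def semilinearComap (θ : g ≃ₗ⁅ℂ⁆ g) (Φ : M ≃ₗ[ℂ] M')
    (hΦ : ∀ (z : g) (m : M), Φ ⁅z, m⁆ = ⁅θ z, Φ m⁆) (W : LieSubmodule ℂ g M') :
    LieSubmodule ℂ g M where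
  __ := W.toSubmodule.comap Φ.toLinearMap
  lie_mem {z m} hm := by
    change Φ ⁅z, m⁆ ∈ W
    rw [hΦ]
    exact W.lie_mem hm

lemma map_mem_sSup_finiteDimensional {θ : g ≃ₗ⁅ℂ⁆ g} {Φ : M ≃ₗ[ℂ] M'}
    (hΦ : ∀ (z : g) (m : M), Φ ⁅z, m⁆ = ⁅θ z, Φ m⁆) {m : M}
    (hm : m ∈ sSup {W : LieSubmodule ℂ g M | FiniteDimensional ℂ W}) :
    Φ m ∈ sSup {W : LieSubmodule ℂ g M' | FiniteDimensional ℂ W} := by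
  suffices h : sSup {W : LieSubmodule ℂ g M | FiniteDimensional ℂ W} ≤
      semilinearComap θ Φ hΦ (sSup {W : LieSubmodule ℂ g M' | FiniteDimensional ℂ W}) from h hm
  refine sSup_le fun W (hW : FiniteDimensional ℂ W) m hm => ?_
  let W' := semilinearComap θ.symm Φ.symm (semilinear_symm hΦ) W
  have hW' : FiniteDimensional ℂ W' := by
    have h : W'.toSubmodule = W.toSubmodule.map Φ.toLinearMap :=
      (Submodule.map_equiv_eq_comap_symm Φ W.toSubmodule).symm
    change FiniteDimensional ℂ W'.toSubmodule
    rw [h]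
    have : FiniteDimensional ℂ W.toSubmodule := hW
    infer_instance
  refine (le_sSup (a := W') hW') ?_
  change Φ.symm (Φ m) ∈ W
  rwa [Φ.symm_apply_apply]

lemma exists_sSup_finiteDimensional_equiv {θ : g ≃ₗ⁅ℂ⁆ g} {Φ : M ≃ₗ[ℂ] M'}
    (hΦ : ∀ (z : g) (m : M), Φ ⁅z, m⁆ = ⁅θ z, Φ m⁆) :
    ∃ Ψ : ↥(sSup {W : LieSubmodule ℂ g M | FiniteDimensional ℂ W}) ≃ₗ[ℂ]
        ↥(sSup {W : LieSubmodule ℂ g M' | FiniteDimensional ℂ W}),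
      ∀ z m, Ψ ⁅z, m⁆ = ⁅θ z, Ψ m⁆ := by
  refine ⟨Φ.ofSubmodules (sSup {W : LieSubmodule ℂ g M | FiniteDimensional ℂ W}).toSubmodule
    (sSup {W : LieSubmodule ℂ g M' | FiniteDimensional ℂ W}).toSubmodule ?_,
    fun z m => Subtype.ext (hΦ z m)⟩
  ext m
  constructor
  · rintro ⟨m, hm, rfl⟩
    exact map_mem_sSup_finiteDimensional hΦ hm
  · intro hm
    exact ⟨Φ.symm m, map_mem_sSup_finiteDimensional (semilinear_symm hΦ) hm,
      Φ.apply_symm_apply m⟩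

lemma nonempty_induced_equiv {K : LieSubalgebra ℂ g}
    {N : Type*} [AddCommGroup N] [Module ℂ N] [LieRingModule K N] [LieModule ℂ K N]
    {N' : Type*} [AddCommGroup N'] [Module ℂ N'] [LieRingModule K N'] [LieModule ℂ K N']
    (θ : g ≃ₗ⁅ℂ⁆ g) (θK : K ≃ₗ⁅ℂ⁆ K) (hθ : ∀ x : K, θ x = θK x) (ψ : N ≃ₗ[ℂ] N')
    (hψ : ∀ (x : K) (m : N), ψ ⁅x, m⁆ = ⁅θK x, ψ m⁆)
    (h : ∃ Θ : Induced K N ≃ₗ[ℂ] Induced K N, ∀ (x : g) (m : Induced K N),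
      Θ ⁅x, m⁆ = ⁅θ x, Θ m⁆) :
    Nonempty (Induced K N ≃ₗ⁅ℂ, g⁆ Induced K N') := by
  obtain ⟨Φ, hΦ⟩ := exists_coinduced_equiv θ θK hθ ψ hψ
  obtain ⟨Ψ, hΨ⟩ := exists_sSup_finiteDimensional_equiv hΦ
  obtain ⟨Θ, hΘ⟩ := h
  exact nonempty_lieModuleEquiv hΘ hΨ

end Induction

/-! ### Conjugate weights of the Levi subalgebra -/

section Main

universe u

variable {g : Type u} [LieRing g] [LieAlgebra ℂ g] [FiniteDimensional ℂ g] [IsKilling ℂ g]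
  {H : LieSubalgebra ℂ g} [H.IsCartanSubalgebra] (b : (rootSystem H).Base) {T : Set H.root}

lemma IsLift.map_mem_leviSubmodule {θ : g ≃ₗ⁅ℂ⁆ g} {τ : H ≃ₗ[ℂ] H} {u : Dual ℂ H ≃ₗ[ℂ] Dual ℂ H}
    (h : IsLift θ τ u)
    (hu : ∀ α ∈ Submodule.span ℤ ((rootSystem H).root '' T),
      u α ∈ Submodule.span ℤ ((rootSystem H).root '' T)) {x : g} (hx : x ∈ leviSubmodule T) :
    θ x ∈ leviSubmodule T := by
  rw [leviSubmodule_eq_iSup] at hx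
  induction hx using Submodule.iSup_induction' with
  | zero => simp
  | add x y _ _ hx hy => simpa using add_mem hx hy
  | mem χ x hx => exact rootSpace_le_leviSubmodule T _ (hu χ χ.2) (h.mem_rootSpace hx)

/-- An element of the Weyl group preserving the positive roots of the Levi subalgebra lifts to an
automorphism of `g` that restricts to the Levi subalgebra, carries its irreducible module of highest
weight `mu` to that of the transformed highest weight, and is implemented on integrable modules. -/
lemma exists_levi_automorphism (hT : T ⊆ (b.support : Set H.root)) {u : (rootSystem H).weylGroup}
    (hu : (fun α => u • α) '' leviPositiveRoots b T = leviPositiveRoots b T) {mu nu : Dual ℂ H}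
    (hnu : nu = u • mu) :
    ∃ (θ : g ≃ₗ⁅ℂ⁆ g) (θT : leviSubalgebra T ≃ₗ⁅ℂ⁆ leviSubalgebra T)
      (ψ : VLevi b T mu ≃ₗ[ℂ] VLevi b T nu),
      IsImplemented b θ ∧ (∀ x : leviSubalgebra T, θ x = θT x) ∧
        ∀ (x : leviSubalgebra T) (m : VLevi b T mu), ψ ⁅x, m⁆ = ⁅θT x, ψ m⁆ := by
  obtain ⟨θ, τ, hθ, hθ'⟩ := exists_isLift b u
  have hu' : (fun α => u⁻¹ • α) '' leviPositiveRoots b T = leviPositiveRoots b T := by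
    rw [← hu, Set.image_image]
    simp only [inv_smul_smul, Set.image_id', hu]
  have hmem : ∀ x ∈ leviSubalgebra T, θ x ∈ leviSubalgebra T := fun x hx =>
    hθ.map_mem_leviSubmodule (fun α hα => smul_mem_span b hT hu hα) hx
  have hmem' : ∀ x ∈ leviSubalgebra T, θ.symm x ∈ leviSubalgebra T := fun x hx =>
    hθ.symm.map_mem_leviSubmodule (fun α hα => smul_mem_span b hT hu' hα) hx
  let θT : leviSubalgebra T ≃ₗ⁅ℂ⁆ leviSubalgebra T :=
    { toFun := fun x => ⟨θ x, hmem x x.2⟩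
      map_add' := fun x y => Subtype.ext (map_add θ (x : g) y)
      map_smul' := fun c x => Subtype.ext (map_smul θ c (x : g))
      map_lie' := fun {x y} => Subtype.ext (LieEquiv.map_lie θ (x : g) y)
      invFun := fun x => ⟨θ.symm x, hmem' x x.2⟩
      left_inv := fun x => Subtype.ext (θ.symm_apply_apply (x : g))
      right_inv := fun x => Subtype.ext (θ.apply_symm_apply (x : g)) }
  have hθT (x : leviSubalgebra T) : θ x = θT x := rfl
  obtain ⟨ψ, hψ⟩ := exists_irreducibleModule_equiv
    (LieSubalgebra.inclusion (cartan_le_leviSubalgebra T))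
    {x : leviSubalgebra T | ∃ α ∈ leviPositiveRoots b T, (x : g) ∈ rootSpace H (α : H → ℂ)} θT τ
    (fun h => Subtype.ext (hθ.apply_coe h)) (by
      apply Set.Subset.antisymm
      · rintro _ ⟨x, ⟨α, hα, hx⟩, rfl⟩
        exact ⟨u • α, hu ▸ ⟨α, hα, rfl⟩, hθ.mem_rootSpace hx⟩
      · rintro x ⟨α, hα, hx⟩
        exact ⟨θT.symm x, ⟨u⁻¹ • α, hu' ▸ ⟨α, hα, rfl⟩, hθ.symm.mem_rootSpace hx⟩,
          θT.apply_symm_apply x⟩)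
    (lam := mu) (lam' := nu) (fun h => by
      rw [hnu]
      exact hθ.apply_apply mu h)
  exact ⟨θ, θT, ψ, hθ', hθT, hψ⟩

lemma branchingCoefficient_smul (hT : T ⊆ (b.support : Set H.root))
    {u : (rootSystem H).weylGroup}
    (hu : (fun α => u • α) '' leviPositiveRoots b T = leviPositiveRoots b T) {mu nu : Dual ℂ H}
    (hnu : nu = u • mu) {lam : Dual ℂ H} (hlam : lam ∈ dominantWeights (b.support : Set H.root)) :
    branchingCoefficient b T lam mu = branchingCoefficient b T lam nu := by
  obtain ⟨θ, θT, ψ, hθ, hθT, hψ⟩ := exists_levi_automorphism b hT hu hnu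
  obtain ⟨Θ, hΘ⟩ := hθ (V b lam) (isIntegrable_V b hlam)
  have hΘT (x : leviSubalgebra T) (m : V b lam) : Θ ⁅x, m⁆ = ⁅θT x, Θ m⁆ := by
    rw [LieSubalgebra.coe_bracket_of_module, LieSubalgebra.coe_bracket_of_module, hΘ, hθT]
  exact finrank_lieModuleHom_eq hψ hΘT

lemma nonempty_inducedModule_equiv (hT : T ⊆ (b.support : Set H.root))
    {u : (rootSystem H).weylGroup}
    (hu : (fun α => u • α) '' leviPositiveRoots b T = leviPositiveRoots b T) {mu nu : Dual ℂ H}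
    (hnu : nu = u • mu) :
    Nonempty (InducedModule b T mu ≃ₗ⁅ℂ, g⁆ InducedModule b T nu) := by
  obtain ⟨θ, θT, ψ, hθ, hθT, hψ⟩ := exists_levi_automorphism b hT hu hnu
  exact nonempty_induced_equiv θ θT hθT ψ hψ
    (hθ (Induced _ _) (isIntegrable_sSup_finiteDimensional b _))

end Main

end LeviInduction

end

theorem mainTheorem3 {g : Type*} [LieRing g] [LieAlgebra ℂ g] [FiniteDimensional ℂ g]
    [IsSimple ℂ g] (H : LieSubalgebra ℂ g) [H.IsCartanSubalgebra]
    (b : (rootSystem H).Base) (T : Set H.root) (hT : T ⊆ (b.support : Set H.root)) :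
    (∀ u : (rootSystem H).weylGroup,
      (fun α => u • α) '' LeviInduction.leviPositiveRoots b T =
          LeviInduction.leviPositiveRoots b T ↔
        LeviInduction.IsDynkinAutomorphism T u) ∧
    ∀ μ ∈ LeviInduction.dominantWeights T, ∀ ν ∈ LeviInduction.dominantWeights T,
      (∃ u : (rootSystem H).weylGroup,
        (fun α => u • α) '' LeviInduction.leviPositiveRoots b T =
          LeviInduction.leviPositiveRoots b T ∧ ν = u • μ) →
      LeviInduction.inducedCharacter b T μ = LeviInduction.inducedCharacter b T ν ∧
      Nonempty (LeviInduction.InducedModule b T μ ≃ₗ⁅ℂ, g⁆ LeviInduction.InducedModule b T ν) := by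
  refine ⟨LeviInduction.image_leviPositiveRoots_eq_iff b hT, ?_⟩
  rintro μ - ν - ⟨u, hu, hν⟩
  refine ⟨funext fun lam => ?_, LeviInduction.nonempty_inducedModule_equiv b hT hu hν⟩
  exact congrArg Nat.cast (LeviInduction.branchingCoefficient_smul b hT hu hν lam.2)
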